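/- Let $T\ge 1$ and let $a_1,\dots,a_T>0$ and $b_1,\dots,b_T\in\mathbb R$, extended $T$-periodically to all indices (so $a_0=a_T$). Let $J_T$ be the period-$T$ Jacobi operator on sequences $(u_n)_{n\ge 1}$, $$(J_Tu)_1=b_1u_1+a_1u_2,\qquad (J_Tu)_n=a_{n-1}u_{n-1}+b_nu_n+a_nu_{n+1}\quad(n\ge 2).$$ For $\lambda\in\mathbb R$ let $M(\lambda)=B_T(\lambda)\cdots B_1(\lambda)$ be the monodromy matrix, where $$B_i(\lambda)=\begin{pmatrix}0&1\\-\frac{a_{i-1}}{a_i}&\frac{\lambda-b_i}{a_i}\end{pmatrix},$$ and let $\sigma_{ell}(J_T)=\{\lambda\in\mathbb R: |\operatorname{Tr}M(\lambda)|<2\}$. For $\lambda\in\sigma_{ell}(J_T)$ the quasi-momentum $\theta(\lambda)$ is the number in $(0,\pi)$ for which $M(\lambda)$ has eigenvalues $e^{\pm i\theta(\lambda)}$. Let $(\lambda_i)_{i\ge 3}$ be a sequence in $\sigma_{ell}(J_T)$ such that for every $n\ge 3$ the numbers $\pi,\theta(\lambda_3),\theta(\lambda_4),\dots,\theta(\lambda_n)$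 are linearly independent over $\mathbb Q$, and let $\lambda_1,\lambda_2\in\sigma_{ell}(J_T)$ satisfy either $0<\theta(\lambda_1)<\theta(\lambda_2)<\frac{\pi}{2}$ or $\frac{\pi}{2}<\theta(\lambda_1)<\theta(\lambda_2)<\pi$. Then for any sequence of positive numbers $K(n)$, $n\ge1$, with $K(n)\to\infty$ (arbitrarily slowly) as $n\to\infty$, there exists a real potential $(q_n)_{n\ge 1}$ with $|q_n|\le\frac{K(n)}{n}$ for all $n\ge 1$ and $q_n\to 0$, and for every $i\ge 1$ a non-zero vector $(u_{n,i})_{n\ge1}\in\ell^2(\mathbb N;\mathbb R)$, such that $$(J_T+Q)(u_{n,i})_{n\ge 1}=\lambda_i\,(u_{n,i})_{n\ge 1}\qquad\text{for all } i\ge 1,$$ where $Q$ is the infinite diagonal matrix with entries $(q_n)$; the same potential serves all $i$. -/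

import Mathlib

open Filter Topology

/-- The coefficients of a period-`T` Jacobi operator: real sequences `a₁, a₂, …` (positive) and
`b₁, b₂, …` that repeat with period `T`. The entry with index `0` is the periodic continuation,
so that `a 0 = a T`. -/
structure PeriodicJacobi (T : ℕ+) where
  a : ℕ → ℝ
  b : ℕ → ℝ
  a_pos : ∀ n, 0 < a n
  a_periodic : ∀ n, a (n + T) = a n
  b_periodic : ∀ n, b (n + T) = b n

namespace PeriodicJacobi

variable {T : ℕ+} (J : PeriodicJacobi T)

/-- The half-line tridiagonal matrix `J_T`, acting on real sequences `(u_n)_{n ≥ 1}`: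
`(J_T u)_n = a_{n-1} u_{n-1} + b_n u_n + a_n u_{n+1}`, where the first summand is absent for
`n = 1`. -/
noncomputable def op : (ℕ+ → ℝ) →ₗ[ℝ] (ℕ+ → ℝ) where
  toFun u n := (if 1 < n then J.a ((n : ℕ) - 1) * u (n - 1) else 0)
    + J.b n * u n + J.a n * u (n + 1)
  map_add' u v := by
    funext n
    by_cases h : 1 < n <;> simp [h] <;> ring
  map_smul' c u := by
    funext n
    by_cases h : 1 < n <;> simp [h] <;> ring

/-- The transfer matrix `B_{k+1}(lam)`, for `k = 0, 1, 2, …`. -/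
noncomputable def transfer (lam : ℝ) (k : ℕ) : Matrix (Fin 2) (Fin 2) ℝ :=
  !![0, 1; -(J.a k / J.a (k + 1)), (lam - J.b (k + 1)) / J.a (k + 1)]

/-- The product `B_n(lam) ⋯ B_1(lam)`. -/
noncomputable def transferProd (lam : ℝ) : ℕ → Matrix (Fin 2) (Fin 2) ℝ
  | 0 => 1
  | n + 1 => J.transfer lam n * transferProd lam n

/-- The monodromy matrix `M(lam) = B_T(lam) ⋯ B_1(lam)`. -/
noncomputable def monodromy (lam : ℝ) : Matrix (Fin 2) (Fin 2) ℝ :=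
  J.transferProd lam T

/-- The generalised interior of the essential spectrum: the elliptic points. -/
def sigmaEll : Set ℝ := {lam | |(J.monodromy lam).trace| < 2}

/-- The quasi-momentum `θ(lam)`; see `quasiMomentum_eq_iff` for its characterization through the
eigenvalues `e^{± i θ(lam)}` of the monodromy matrix at elliptic points. -/
noncomputable def quasiMomentum (lam : ℝ) : ℝ :=
  Real.arccos ((J.monodromy lam).trace / 2)

theorem det_transferProd (lam : ℝ) (n : ℕ) : (J.transferProd lam n).det = J.a 0 / J.a n := by
  induction n with
  | zero => simp [transferProd, div_self (J.a_pos 0).ne']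
  | succ n ih =>
    have h1 := (J.a_pos n).ne'
    have h2 := (J.a_pos (n + 1)).ne'
    rw [transferProd, Matrix.det_mul, ih, transfer, Matrix.det_fin_two_of]
    field_simp
    ring

theorem det_monodromy (lam : ℝ) : (J.monodromy lam).det = 1 := by
  have h := J.a_periodic 0
  rw [zero_add] at h
  rw [monodromy, det_transferProd, h, div_self (J.a_pos 0).ne']

/-- At an elliptic point, `θ(lam)` is the unique number in `(0, π)` such that the monodromy matrix
has the eigenvalues `e^{iθ}` and `e^{-iθ}`. -/
theorem quasiMomentum_eq_iff {lam : ℝ} (h : lam ∈ J.sigmaEll) (t : ℝ) :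
    J.quasiMomentum lam = t ↔ t ∈ Set.Ioo 0 Real.pi ∧
      ((J.monodromy lam).map Complex.ofReal).charpoly.roots =
        {Complex.exp (t * Complex.I), Complex.exp (-(t * Complex.I))} := by
  have key : ∀ s : ℝ, ((J.monodromy lam).map Complex.ofReal).charpoly.roots =
        {Complex.exp (s * Complex.I), Complex.exp (-(s * Complex.I))} ↔
      (J.monodromy lam).trace = 2 * Real.cos s := by
    intro s
    have hdet : ((J.monodromy lam).map Complex.ofReal).det = 1 := by
      have := Complex.ofRealHom.map_det (J.monodromy lam)
      rw [J.det_monodromy] at this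
      have h2 : ((J.monodromy lam).map Complex.ofRealHom).det = 1 := by simpa using this.symm
      exact h2
    have htr : ((J.monodromy lam).map Complex.ofReal).trace
        = (((J.monodromy lam).trace : ℝ) : ℂ) := by
      simp [Matrix.trace_fin_two]
    have hc : Complex.exp (s * Complex.I) + Complex.exp (-(s * Complex.I))
        = ((2 * Real.cos s : ℝ) : ℂ) := by
      push_cast
      rw [Complex.cos]
      ring_nf
    have hm : Complex.exp (s * Complex.I) * Complex.exp (-(s * Complex.I)) = 1 := by
      rw [← Complex.exp_add]; simp
    constructor
    · intro hr
      have h1 := Matrix.trace_eq_sum_roots_charpoly ((J.monodromy lam).map Complex.ofReal)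
      rw [hr, htr] at h1
      simp only [Multiset.insert_eq_cons, Multiset.sum_cons, Multiset.sum_singleton] at h1
      rw [hc] at h1
      exact_mod_cast h1
    · intro ht
      have hp : ((J.monodromy lam).map Complex.ofReal).charpoly =
          (Polynomial.X - Polynomial.C (Complex.exp (s * Complex.I))) *
          (Polynomial.X - Polynomial.C (Complex.exp (-(s * Complex.I)))) := by
        rw [Matrix.charpoly_fin_two, hdet, htr, ht, ← hc, ← hm, map_add, map_mul]
        ring
      rw [hp, Polynomial.roots_mul (mul_ne_zero (Polynomial.X_sub_C_ne_zero _)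
        (Polynomial.X_sub_C_ne_zero _)), Polynomial.roots_X_sub_C, Polynomial.roots_X_sub_C]
      rfl
  rw [key]
  have h' := abs_lt.1 (show |(J.monodromy lam).trace| < 2 from h)
  constructor
  · rintro rfl
    refine ⟨⟨Real.arccos_pos.2 (by linarith), ?_⟩, ?_⟩
    · refine lt_of_le_of_ne (Real.arccos_le_pi _) fun hpi => ?_
      have := Real.arccos_eq_pi.1 hpi
      linarith
    · rw [quasiMomentum, Real.cos_arccos (by linarith) (by linarith)]
      ring
  · rintro ⟨ht, h2⟩
    rw [quasiMomentum, h2, mul_div_cancel_left₀ _ two_ne_zero,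
      Real.arccos_cos ht.1.le ht.2.le]

end PeriodicJacobi

/-- The infinite diagonal matrix `Q` with entries `(q_n)_{n ≥ 1}`, acting on real sequences. -/
noncomputable def diagOp (q : ℕ+ → ℝ) : (ℕ+ → ℝ) →ₗ[ℝ] (ℕ+ → ℝ) :=
  LinearMap.pi fun n => q n • LinearMap.proj n

/-! At an elliptic point the periodic equation has a bounded complex Floquet solution ψ whose
multiplier ξ has modulus 1. Variation of constants turns `u n = Im (Z n * ψ n)` into a solution of
the perturbed equation when Z evolves by `kick` (`IsFloquet.im_recurrence`), so it suffices that Z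
be square summable. Write p = Z / conj Z and A = ψ². One step multiplies |Z|² by at most exp(-q
Im(pA) + O(q²)), while p turns by the angle q(|A| - Re(pA)) to first order.

This suggests the feedback q n = (κ + ∑ c_i Im(p_i A_i)) / n. The exponent of |Z_l|² is then minus
the logarithmic sum of κ Im(p_l A_l) + ∑ c_i Im(p_i A_i) Im(p_l A_l), up to quadratic terms. The
square i = l contributes half the mean m_l of |A_l|²; the other terms must be averaged out or
dominated. Since phases move by O(1/n) per step, summation by parts removes every coefficient
sequence with multiplier ≠ 1. Resonances remain. If ξ_i² ξ_l² = 1, the drift κ makes p_i p_l rotate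
at rate κ(|A_i| + |A_l|)/n, and a large κ averages the product A_i A_l out. If ξ_i² = ξ_l² with i ≠
l, either A_i and A_l are not proportional, and strict Cauchy–Schwarz keeps the mean of A_i conj A_l
below √(m_i m_l); or they are, with a factor that is not unimodular (`eq_of_sq_eq`), so the two
rotation rates differ on average and the drift works again.

The conditions on the quasi-momenta leave each spectral value at most one resonant partner of the
second kind. Weights c_i proportional to 1/√m_i therefore leave a net decay, which scaling raises to
|Z|² = O(n^(-3/2)) (`exists_weights`, `exists_feedbackPotential`). For countably many values the
controlled finite family grows in stages, each starting only when K n and √n exceed the constant it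
needs (`exists_potential`). -/

/-! ### Bounded primitives of periodic and quasi-periodic sequences -/

theorem exists_norm_bound_of_multiplier {T : ℕ} (hT : 0 < T) {g : ℕ → ℂ} {y : ℂ}
    (hg : ∀ n, g (n + T) = y * g n) (hy : ‖y‖ = 1) : ∃ E, ∀ n, ‖g n‖ ≤ E := by
  have hper : Function.Periodic (fun n => ‖g n‖) T := fun n => by
    simp [hg, hy]
  refine ⟨∑ m ∈ Finset.range T, ‖g m‖, fun n => ?_⟩
  rw [← hper.map_mod_nat n]
  exact Finset.single_le_sum (f := fun m => ‖g m‖) (fun _ _ => norm_nonneg _)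
    (Finset.mem_range.2 (Nat.mod_lt _ hT))

/-- The sum of g over a window of length T changes by g (n + T) - g n = (y - 1) g n when the window
moves by one. -/
theorem exists_primitive_of_multiplier {T : ℕ} {g : ℕ → ℂ} {y : ℂ} {E : ℝ}
    (hg : ∀ n, g (n + T) = y * g n) (hy : y ≠ 1) (hb : ∀ n, ‖g n‖ ≤ E) :
    ∃ H : ℕ → ℂ, (∃ E, ∀ n, ‖H n‖ ≤ E) ∧ ∀ n, g n = H (n + 1) - H n := by
  have hy' : y - 1 ≠ 0 := sub_ne_zero.2 hy
  refine ⟨fun n => (∑ m ∈ Finset.range T, g (n + m)) / (y - 1),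
    ⟨(T * E) / ‖y - 1‖, fun n => ?_⟩, fun n => ?_⟩
  · rw [norm_div]
    gcongr
    refine (norm_sum_le _ _).trans ?_
    refine (Finset.sum_le_sum fun m _ => hb (n + m)).trans ?_
    simp
  · have h1 := Finset.sum_range_succ (fun m => g (n + m)) T
    have h2 := Finset.sum_range_succ' (fun m => g (n + m)) T
    have h3 : ∀ m, n + (m + 1) = n + 1 + m := fun m => by omega
    rw [Finset.sum_congr rfl fun m _ => congrArg g (h3 m)] at h2
    rw [h1, hg] at h2
    rw [div_sub_div_same, eq_div_iff hy']
    simp only [add_zero] at h2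
    linear_combination h2

/-- After subtraction of the mean the partial sums are themselves T-periodic, hence bounded. -/
theorem exists_primitive_of_periodic {T : ℕ} (hT : 0 < T) {g : ℕ → ℂ}
    (hg : ∀ n, g (n + T) = g n) :
    ∃ H : ℕ → ℂ, (∃ E, ∀ n, ‖H n‖ ≤ E) ∧
      ∀ n, g n = H (n + 1) - H n + (∑ m ∈ Finset.range T, g m) / T := by
  set ν := (∑ m ∈ Finset.range T, g m) / T with hν
  have hT' : (T : ℂ) ≠ 0 := by exact_mod_cast hT.ne'
  have hper : ∀ n, ∑ m ∈ Finset.range T, g (n + m) = T * ν := by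
    intro n
    induction n with
    | zero => simp [hν]; field_simp
    | succ n ih =>
      have h1 := Finset.sum_range_succ (fun m => g (n + m)) T
      have h2 := Finset.sum_range_succ' (fun m => g (n + m)) T
      have h3 : ∀ m, n + (m + 1) = n + 1 + m := fun m => by omega
      rw [Finset.sum_congr rfl fun m _ => congrArg g (h3 m)] at h2
      rw [h1, hg, ih] at h2
      simp only [add_zero] at h2
      linear_combination -h2
  have hH : ∀ n, ∑ m ∈ Finset.range (n + T), (g m - ν) = 1 * ∑ m ∈ Finset.range n, (g m - ν) := by
    intro n
    rw [Finset.sum_range_add, Finset.sum_sub_distrib (fun x => g (n + x)), hper n]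
    simp
  exact ⟨fun n => ∑ m ∈ Finset.range n, (g m - ν),
    exists_norm_bound_of_multiplier hT hH (by simp), fun n => by
      simp only [Finset.sum_range_succ]; ring⟩

/-! ### Summation by parts against slowly varying sequences -/

/-- A sequence in the closed unit disc whose increments on `[N, M)` are at most `D / n`. -/
structure SlowlyVarying (D : ℝ) (N M : ℕ) (P : ℕ → ℂ) : Prop where
  norm_le : ∀ n, ‖P n‖ ≤ 1
  norm_sub_le : ∀ n, N ≤ n → n < M → ‖P (n + 1) - P n‖ ≤ D / n

namespace SlowlyVarying

variable {D D' : ℝ} {N M : ℕ} {P Q : ℕ → ℂ}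

theorem one (N M : ℕ) : SlowlyVarying 0 N M fun _ => 1 :=
  ⟨fun _ => by simp, fun n _ _ => by simp⟩

theorem star (h : SlowlyVarying D N M P) :
    SlowlyVarying D N M fun n => starRingEnd ℂ (P n) :=
  ⟨fun n => by simpa using h.norm_le n, fun n h1 h2 => by
    rw [← map_sub, RCLike.norm_conj]; exact h.norm_sub_le n h1 h2⟩

theorem mul (hP : SlowlyVarying D N M P) (hQ : SlowlyVarying D' N M Q) :
    SlowlyVarying (D + D') N M fun n => P n * Q n := by
  refine ⟨fun n => ?_, fun n h1 h2 => ?_⟩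
  · rw [norm_mul]
    exact mul_le_one₀ (hP.norm_le n) (norm_nonneg _) (hQ.norm_le n)
  · have : P (n + 1) * Q (n + 1) - P n * Q n
        = (P (n + 1) - P n) * Q (n + 1) + P n * (Q (n + 1) - Q n) := by ring
    rw [this, add_div]
    refine (norm_add_le _ _).trans ?_
    rw [norm_mul, norm_mul]
    have a1 := hP.norm_sub_le n h1 h2
    have a2 := hQ.norm_sub_le n h1 h2
    exact add_le_add ((mul_le_of_le_one_right (norm_nonneg _) (hQ.norm_le _)).trans a1)
      ((mul_le_of_le_one_left (norm_nonneg _) (hP.norm_le _)).trans a2)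

/-- Summation by parts: logarithmic averages of a bounded coboundary against a slowly varying
sequence are small. -/
theorem norm_sum_le {E : ℝ} {H : ℕ → ℂ} (hP : SlowlyVarying D N M P) (hE : ∀ n, ‖H n‖ ≤ E)
    (hD : 0 ≤ D) (hN : 1 ≤ N) (hNM : N ≤ M) :
    ‖∑ n ∈ Finset.Ico N M, (1 / n : ℂ) * (P n * (H (n + 1) - H n))‖ ≤ E * (D + 3) / N := by
  have hE0 : 0 ≤ E := (norm_nonneg _).trans (hE 0)
  -- With the boundary term split off, each step costs at most E (D + 1) / (k (k + 1)), which
  -- telescopes.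
  have key : ∀ k, N ≤ k → k ≤ M →
      ‖(∑ n ∈ Finset.Ico N k, (1 / n : ℂ) * (P n * (H (n + 1) - H n))) - P k * H k / k‖
        ≤ E / N + E * (D + 1) * (1 / N - 1 / k) := by
    intro k hk
    induction k, hk using Nat.le_induction with
    | base =>
      intro _
      simp only [Finset.Ico_self, Finset.sum_empty, zero_sub, norm_neg, sub_self, mul_zero,
        add_zero, norm_div, norm_mul, Complex.norm_natCast]
      gcongr
      exact (mul_le_of_le_one_left (norm_nonneg _) (hP.norm_le _)).trans (hE N)
    | succ k hk ih =>
      intro hkM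
      have ih := ih (by omega)
      have hk0 : 0 < k := by omega
      have hkR : (0 : ℝ) < k := by exact_mod_cast hk0
      have hkC : (k : ℂ) ≠ 0 := by exact_mod_cast hk0.ne'
      have hkC1 : (k : ℂ) + 1 ≠ 0 := by exact_mod_cast (Nat.succ_ne_zero k)
      rw [Finset.sum_Ico_succ_top hk]
      have e : (∑ n ∈ Finset.Ico N k, (1 / n : ℂ) * (P n * (H (n + 1) - H n)))
            + (1 / k : ℂ) * (P k * (H (k + 1) - H k)) - P (k + 1) * H (k + 1) / ((k + 1 : ℕ) : ℂ)
          = ((∑ n ∈ Finset.Ico N k, (1 / n : ℂ) * (P n * (H (n + 1) - H n))) - P k * H k / k)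
            + (P k * (1 / k - 1 / (k + 1)) - (P (k + 1) - P k) * (1 / (k + 1))) * H (k + 1) := by
        push_cast
        field_simp
        ring
      rw [e]
      refine (norm_add_le _ _).trans ?_
      have b : ‖(P k * (1 / k - 1 / (k + 1)) - (P (k + 1) - P k) * (1 / (k + 1))) * H (k + 1)‖
          ≤ (1 / k - 1 / (k + 1) + D / k * (1 / (k + 1))) * E := by
        rw [norm_mul]
        refine _root_.mul_le_mul ?_ (hE _) (norm_nonneg _) ?_
        · refine (_root_.norm_sub_le _ _).trans (add_le_add ?_ ?_)
          · rw [norm_mul]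
            have : (1 / k - 1 / (k + 1) : ℂ) = ((1 / k - 1 / (k + 1) : ℝ) : ℂ) := by push_cast; rfl
            rw [this, Complex.norm_real, Real.norm_eq_abs, abs_of_nonneg]
            · exact mul_le_of_le_one_left (sub_nonneg.2 (by gcongr; linarith)) (hP.norm_le _)
            · exact sub_nonneg.2 (by gcongr; linarith)
          · rw [norm_mul]
            have : (1 / (k + 1) : ℂ) = ((1 / (k + 1) : ℝ) : ℂ) := by push_cast; rfl
            rw [this, Complex.norm_real, Real.norm_eq_abs, abs_of_nonneg (by positivity)]
            exact mul_le_mul_of_nonneg_right (hP.norm_sub_le k hk hkM) (by positivity)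
        · have : (0:ℝ) ≤ 1 / k - 1 / (k + 1) := sub_nonneg.2 (by gcongr; linarith)
          positivity
      have e2 : (1 / k - 1 / (k + 1) + D / k * (1 / (k + 1))) * E
          = E * (D + 1) * (1 / k - 1 / ((k : ℝ) + 1)) := by
        field_simp
        ring
      rw [e2] at b
      push_cast
      linarith
  have hNR : (0 : ℝ) < N := by exact_mod_cast hN
  have hMR : (N : ℝ) ≤ M := by exact_mod_cast hNM
  have h1 := key M hNM le_rfl
  have h2 : ‖P M * H M / M‖ ≤ E / N := by
    rw [norm_div, norm_mul, Complex.norm_natCast]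
    gcongr
    exact (mul_le_of_le_one_left (norm_nonneg _) (hP.norm_le _)).trans (hE M)
  have h3 := norm_le_norm_sub_add
    (∑ n ∈ Finset.Ico N M, (1 / n : ℂ) * (P n * (H (n + 1) - H n))) (P M * H M / M)
  have h4 : E * (D + 1) * (1 / N - 1 / M) ≤ E * (D + 1) * (1 / N) := by
    gcongr
    exact sub_le_self _ (by positivity)
  have h5 : E * (D + 3) / N = E / N + E * (D + 1) * (1 / N) + E / N := by
    field_simp; ring
  linarith

end SlowlyVarying

theorem eventually_norm_sum_le {H : ℕ → ℂ} {D ε : ℝ} (hH : ∃ E, ∀ n, ‖H n‖ ≤ E) (hD : 0 ≤ D)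
    (hε : 0 < ε) :
    ∀ᶠ N : ℕ in atTop, ∀ M, N ≤ M → ∀ P, SlowlyVarying D N M P →
      ‖∑ n ∈ Finset.Ico N M, (1 / n : ℂ) * (P n * (H (n + 1) - H n))‖ ≤ ε := by
  obtain ⟨E, hE⟩ := hH
  have ht : Tendsto (fun N : ℕ => E * (D + 3) / N) atTop (𝓝 0) :=
    tendsto_const_div_atTop_nhds_zero_nat _
  filter_upwards [ht.eventually (ge_mem_nhds hε), eventually_ge_atTop 1] with N h1 h2 M hM P hP
  exact (hP.norm_sum_le hE hD h2 hM).trans h1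

theorem sum_Ico_one_div_sq_le {N M : ℕ} (hN : 1 ≤ N) (hNM : N ≤ M) :
    ∑ n ∈ Finset.Ico N M, (1 / (n : ℝ) ^ 2) ≤ 2 / (N : ℝ) := by
  have hNR : (0 : ℝ) < N := by exact_mod_cast hN
  have key : ∑ n ∈ Finset.Ico N M, (1 / (n : ℝ) ^ 2) ≤ 2 / (N : ℝ) - 2 / (M : ℝ) := by
    induction M, hNM using Nat.le_induction with
    | base => simp
    | succ k hk ih =>
      rw [Finset.sum_Ico_succ_top hk]
      have hk1 : (1 : ℝ) ≤ k := by exact_mod_cast (by omega : 1 ≤ k)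
      have h2 : 1 / (k : ℝ) ^ 2 ≤ 2 / k - 2 / (k + 1) := by
        rw [div_sub_div _ _ (by positivity) (by positivity), div_le_div_iff₀ (by positivity)
          (by positivity)]
        nlinarith
      push_cast
      linarith
  have : (0 : ℝ) ≤ 2 / (M : ℝ) := by positivity
  linarith

/-! ### One step of variation of constants: modulus and phase -/

/-- The squared phase `z² / |z|²` of a complex number. -/
noncomputable def sqPhase (z : ℂ) : ℂ := z / starRingEnd ℂ z

/-- One step of the variation of constants: the effect of the potential value `q` on the
coefficient `z` of the Floquet solution with value `v`. -/
noncomputable def kick (q : ℝ) (v z : ℂ) : ℂ := z - ((q * (z * v).im : ℝ) : ℂ) * starRingEnd ℂ v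

theorem norm_sqPhase_le (z : ℂ) : ‖sqPhase z‖ ≤ 1 := by
  rw [sqPhase, norm_div, RCLike.norm_conj]
  exact div_self_le_one _

/-- The correction is a real multiple of conj v, and conj v * v is real. Hence the solution value at
the site of the kick is the same before and after it. -/
theorem im_kick_mul (q : ℝ) (v z : ℂ) : (kick q v z * v).im = (z * v).im := by
  simp [kick, Complex.mul_im]
  ring

theorem kick_ne_zero {q : ℝ} {v z : ℂ} (hz : z ≠ 0) : kick q v z ≠ 0 := by
  intro h
  have h1 := im_kick_mul q v z
  rw [h, zero_mul, Complex.zero_im] at h1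
  rw [kick, ← h1] at h
  simp at h
  exact hz h

theorem sqPhase_mul_normSq (z : ℂ) : sqPhase z * ((‖z‖ ^ 2 : ℝ) : ℂ) = z ^ 2 := by
  rcases eq_or_ne z 0 with rfl | hz
  · simp [sqPhase]
  · have h : starRingEnd ℂ z ≠ 0 := by simpa using hz
    have h2 : ((‖z‖ ^ 2 : ℝ) : ℂ) = z * starRingEnd ℂ z := by
      rw [Complex.mul_conj, Complex.normSq_eq_norm_sq]
    rw [h2, sqPhase]
    field_simp

/-- Expanding the square, the linear term is q Im((zv)²) = q |z|² Im(p v²) with p the squared phase;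
then 1 + x ≤ exp x. -/
theorem norm_kick_sq_le (q : ℝ) (v z : ℂ) :
    ‖kick q v z‖ ^ 2 ≤
      ‖z‖ ^ 2 * Real.exp (-(q * (sqPhase z * v ^ 2).im) + (q * ‖v ^ 2‖) ^ 2) := by
  have h1 : (sqPhase z * v ^ 2).im * ‖z‖ ^ 2 = 2 * (z * v).im * (z * v).re := by
    rw [← Complex.im_mul_ofReal, mul_right_comm, sqPhase_mul_normSq, ← mul_pow, sq,
      Complex.mul_im (z * v)]
    ring
  have h2 : ‖kick q v z‖ ^ 2 = ‖z‖ ^ 2 - 2 * q * (z * v).im * (z * v).re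
      + q ^ 2 * (z * v).im ^ 2 * ‖v‖ ^ 2 := by
    simp only [← Complex.normSq_eq_norm_sq, Complex.normSq_apply, kick, Complex.sub_re,
      Complex.sub_im, Complex.conj_re, Complex.conj_im, Complex.mul_re, Complex.mul_im,
      Complex.ofReal_re, Complex.ofReal_im]
    ring
  have h3 : (z * v).im ^ 2 ≤ ‖z‖ ^ 2 * ‖v‖ ^ 2 := by
    rw [← mul_pow, ← norm_mul, ← sq_abs]
    exact pow_le_pow_left₀ (abs_nonneg _) (Complex.abs_im_le_norm _) 2
  have h4 : q ^ 2 * (z * v).im ^ 2 * ‖v‖ ^ 2 ≤ q ^ 2 * (‖z‖ ^ 2 * ‖v‖ ^ 2) * ‖v‖ ^ 2 := by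
    gcongr
  have h5 := Real.add_one_le_exp (-(q * (sqPhase z * v ^ 2).im) + (q * ‖v ^ 2‖) ^ 2)
  have h6 := mul_le_mul_of_nonneg_left h5 (sq_nonneg ‖z‖)
  refine le_trans ?_ h6
  rw [norm_pow]
  linear_combination h2 + h4 + q * h1

/-- The kick multiplies z by some 1 + t, so the phase p becomes p (1 + t) / (1 + conj t), which to
first order is p (1 + t - conj t). The error is p (t - conj t) conj t / (1 + conj t) up to sign, and
|1 + conj t| ≥ 1/2. -/
theorem norm_sqPhase_kick_sub_le {q : ℝ} {v z : ℂ} (hz : z ≠ 0) (hq : |q| * ‖v ^ 2‖ ≤ 1 / 2) :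
    ‖sqPhase (kick q v z) - sqPhase z
      - Complex.I * (q : ℂ) * sqPhase z * ((‖v ^ 2‖ - (sqPhase z * v ^ 2).re : ℝ) : ℂ)‖
      ≤ 4 * (|q| * ‖v ^ 2‖) ^ 2 := by
  set p := sqPhase z with hp
  have hzc : starRingEnd ℂ z ≠ 0 := by simpa using hz
  have hpn : ‖p‖ ≤ 1 := norm_sqPhase_le z
  set t : ℂ := Complex.I * q / 2 * (‖v ^ 2‖ - starRingEnd ℂ (p * v ^ 2)) with ht
  have hvv : ((‖v ^ 2‖ : ℝ) : ℂ) = v * starRingEnd ℂ v := by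
    rw [Complex.mul_conj, Complex.normSq_eq_norm_sq, norm_pow]
  have hk : kick q v z = z * (1 + t) := by
    have him : (((z * v).im : ℝ) : ℂ)
        = (z * v - starRingEnd ℂ (z * v)) / (2 * Complex.I) := by
      rw [Complex.sub_conj]
      push_cast
      field_simp
    rw [kick, Complex.ofReal_mul, him, ht, hvv, hp, sqPhase]
    simp only [map_mul, map_div₀, Complex.conj_conj, map_pow]
    field_simp
    linear_combination (q : ℂ) * starRingEnd ℂ v * (z * v - starRingEnd ℂ z * starRingEnd ℂ v)
      * (-Complex.I_sq)
  have htn : ‖t‖ ≤ |q| * ‖v ^ 2‖ := by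
    rw [ht, norm_mul, norm_div, norm_mul, Complex.norm_I, one_mul, Complex.norm_real,
      Real.norm_eq_abs, Complex.norm_two]
    have : ‖(‖v ^ 2‖ : ℂ) - starRingEnd ℂ (p * v ^ 2)‖ ≤ ‖v ^ 2‖ + ‖v ^ 2‖ := by
      refine (norm_sub_le _ _).trans (add_le_add (by simp) ?_)
      rw [RCLike.norm_conj, norm_mul]
      exact mul_le_of_le_one_left (norm_nonneg _) hpn
    have h := mul_le_mul_of_nonneg_left this (show 0 ≤ |q| / 2 by positivity)
    linarith
  have htc : ‖starRingEnd ℂ t‖ = ‖t‖ := RCLike.norm_conj t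
  have h1 : 1 / 2 ≤ ‖1 + starRingEnd ℂ t‖ := by
    have := norm_sub_norm_le (1 : ℂ) (-starRingEnd ℂ t)
    rw [sub_neg_eq_add, norm_neg, norm_one, htc] at this
    linarith
  have h1' : 1 + starRingEnd ℂ t ≠ 0 := by
    intro h; rw [h, norm_zero] at h1; linarith
  have hd : t - starRingEnd ℂ t
      = Complex.I * (q : ℂ) * ((‖v ^ 2‖ - (p * v ^ 2).re : ℝ) : ℂ) := by
    have hre : (((p * v ^ 2).re : ℝ) : ℂ) = (p * v ^ 2 + starRingEnd ℂ (p * v ^ 2)) / 2 := by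
      rw [Complex.add_conj]
      push_cast
      ring
    rw [ht, Complex.ofReal_sub, hre]
    simp only [map_mul, map_div₀, map_sub, Complex.conj_conj, Complex.conj_I, Complex.conj_ofReal,
      map_ofNat]
    ring
  have he : sqPhase (kick q v z) - p
      - Complex.I * (q : ℂ) * p * ((‖v ^ 2‖ - (p * v ^ 2).re : ℝ) : ℂ)
      = -(p * (t - starRingEnd ℂ t) * starRingEnd ℂ t / (1 + starRingEnd ℂ t)) := by
    have : sqPhase (kick q v z) = p * (1 + t) / (1 + starRingEnd ℂ t) := by
      rw [hk, sqPhase, hp, sqPhase, map_mul, map_add, map_one]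
      field_simp
    rw [this, mul_right_comm (Complex.I * (q : ℂ)), ← hd]
    field_simp
    ring
  rw [he, norm_neg, norm_div, norm_mul, norm_mul, htc, div_le_iff₀ (by linarith)]
  have h2 : ‖t - starRingEnd ℂ t‖ ≤ 2 * ‖t‖ := by
    refine (norm_sub_le _ _).trans ?_
    rw [htc]; linarith
  calc ‖p‖ * ‖t - starRingEnd ℂ t‖ * ‖t‖ ≤ 1 * (2 * ‖t‖) * ‖t‖ := by gcongr
    _ = 2 * ‖t‖ ^ 2 := by ring
    _ ≤ 2 * (|q| * ‖v ^ 2‖) ^ 2 := by gcongr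
    _ = 4 * (|q| * ‖v ^ 2‖) ^ 2 * (1 / 2) := by ring
    _ ≤ _ := by gcongr

/-! ### The phase equation and averaging by drift -/

/-- The phase equation on `[N, M)` with potential `q` and squared Floquet solution `A`, up to
quadratic terms. The sign `s` is `1` for a phase and `-1` for its conjugate. -/
structure PhaseEquation (q : ℕ → ℝ) (a s : ℝ) (A : ℕ → ℂ) (N M : ℕ) (p : ℕ → ℂ) : Prop where
  norm_le : ∀ n, ‖p n‖ ≤ 1
  norm_coeff_le : ∀ n, ‖A n‖ ≤ a
  small : ∀ n, N ≤ n → n < M → |q n| * a ≤ 1 / 2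
  abs_sign : |s| = 1
  norm_sub_le : ∀ n, N ≤ n → n < M → ‖p (n + 1) - p n
      - Complex.I * (q n : ℂ) * p n * ((s * (‖A n‖ - (p n * A n).re) : ℝ) : ℂ)‖
      ≤ 4 * (|q n| * a) ^ 2

namespace PhaseEquation

variable {q : ℕ → ℝ} {a s s' D : ℝ} {A B : ℕ → ℂ} {N M : ℕ} {p r : ℕ → ℂ}

theorem star (h : PhaseEquation q a s A N M p) :
    PhaseEquation q a (-s) (fun n => starRingEnd ℂ (A n)) N M (fun n => starRingEnd ℂ (p n)) := by
  refine ⟨fun n => by simpa using h.norm_le n, fun n => by simpa using h.norm_coeff_le n, h.small,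
    by rw [abs_neg, h.abs_sign], fun n h1 h2 => ?_⟩
  refine le_trans (le_of_eq ?_) (h.norm_sub_le n h1 h2)
  rw [← RCLike.norm_conj (p (n + 1) - p n
      - Complex.I * (q n : ℂ) * p n * ((s * (‖A n‖ - (p n * A n).re) : ℝ) : ℂ))]
  congr 1
  rw [RCLike.norm_conj, ← map_mul, Complex.conj_re]
  simp only [map_sub, map_mul, Complex.conj_I, Complex.conj_ofReal, Complex.ofReal_mul,
    Complex.ofReal_neg]
  ring

theorem abs_rate_le (h : PhaseEquation q a s A N M p) (n : ℕ) :
    |s * (‖A n‖ - (p n * A n).re)| ≤ 2 * a := by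
  rw [abs_mul, h.abs_sign, one_mul]
  have h1 : |(p n * A n).re| ≤ ‖A n‖ := by
    refine (Complex.abs_re_le_norm _).trans ?_
    rw [norm_mul]
    exact mul_le_of_le_one_left (norm_nonneg _) (h.norm_le n)
  have h2 := h.norm_coeff_le n
  have := norm_nonneg (A n)
  rw [abs_le] at *
  constructor <;> linarith

theorem norm_increment_le (h : PhaseEquation q a s A N M p) {n : ℕ} (h1 : N ≤ n) (h2 : n < M) :
    ‖p (n + 1) - p n‖ ≤ 4 * (|q n| * a) := by
  have ha : 0 ≤ a := (norm_nonneg _).trans (h.norm_coeff_le 0)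
  have h3 := h.norm_sub_le n h1 h2
  have h4 := norm_le_norm_sub_add (p (n + 1) - p n)
    (Complex.I * (q n : ℂ) * p n * ((s * (‖A n‖ - (p n * A n).re) : ℝ) : ℂ))
  have h5 : ‖Complex.I * (q n : ℂ) * p n * ((s * (‖A n‖ - (p n * A n).re) : ℝ) : ℂ)‖
      ≤ |q n| * (2 * a) := by
    rw [norm_mul, norm_mul, norm_mul, Complex.norm_I, one_mul, Complex.norm_real,
      Complex.norm_real, Real.norm_eq_abs, Real.norm_eq_abs]
    exact mul_le_mul (mul_le_of_le_one_right (abs_nonneg _) (h.norm_le n)) (h.abs_rate_le n)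
      (abs_nonneg _) (abs_nonneg _)
  have h6 := h.small n h1 h2
  have h7 : 0 ≤ |q n| * a := by positivity
  nlinarith

theorem slowlyVarying (h : PhaseEquation q a s A N M p)
    (hD : ∀ n, N ≤ n → n < M → |q n| ≤ D / n) : SlowlyVarying (4 * (D * a)) N M p := by
  have ha : 0 ≤ a := (norm_nonneg _).trans (h.norm_coeff_le 0)
  refine ⟨h.norm_le, fun n h1 h2 => (h.norm_increment_le h1 h2).trans ?_⟩
  have := mul_le_mul_of_nonneg_right (hD n h1 h2) ha
  calc 4 * (|q n| * a) ≤ 4 * (D / n * a) := by linarith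
    _ = 4 * (D * a) / n := by ring

/-- Rates add under the product rule. The constant is 4 + 4 from the two errors and 4 · 4 from the
product of the increments. -/
theorem mul (hp : PhaseEquation q a s A N M p) (hr : PhaseEquation q a s' B N M r) {n : ℕ}
    (h1 : N ≤ n) (h2 : n < M) :
    ‖p (n + 1) * r (n + 1) - p n * r n - Complex.I * (q n : ℂ) * (p n * r n) *
      ((s * (‖A n‖ - (p n * A n).re) + s' * (‖B n‖ - (r n * B n).re) : ℝ) : ℂ)‖
      ≤ 24 * (|q n| * a) ^ 2 := by
  have e : p (n + 1) * r (n + 1) - p n * r n - Complex.I * (q n : ℂ) * (p n * r n) *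
      ((s * (‖A n‖ - (p n * A n).re) + s' * (‖B n‖ - (r n * B n).re) : ℝ) : ℂ)
      = (p (n + 1) - p n
          - Complex.I * (q n : ℂ) * p n * ((s * (‖A n‖ - (p n * A n).re) : ℝ) : ℂ)) * r n
        + p n * (r (n + 1) - r n
          - Complex.I * (q n : ℂ) * r n * ((s' * (‖B n‖ - (r n * B n).re) : ℝ) : ℂ))
        + (p (n + 1) - p n) * (r (n + 1) - r n) := by
    rw [Complex.ofReal_add]
    ring
  rw [e]
  refine (norm_add₃_le).trans ?_
  rw [norm_mul, norm_mul, norm_mul]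
  have b1 := mul_le_mul (hp.norm_sub_le n h1 h2) (hr.norm_le n) (norm_nonneg _) (by positivity)
  have b2 := mul_le_mul (hp.norm_le n) (hr.norm_sub_le n h1 h2) (norm_nonneg _) zero_le_one
  have b3 := mul_le_mul (hp.norm_increment_le h1 h2) (hr.norm_increment_le h1 h2) (norm_nonneg _)
    ((norm_nonneg _).trans (hp.norm_increment_le h1 h2))
  nlinarith

/-- If the potential is `(κ + F n) / n`, then the drift `κ` makes the product of two phases
rotate with the rate `κ (s ‖A n‖ + s' ‖B n‖) / n`, which averages this product out. -/
theorem norm_drift_sum_le {κ F₀ ε : ℝ} {F : ℕ → ℝ} (hp : PhaseEquation q a s A N M p)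
    (hr : PhaseEquation q a s' B N M r) (hκ : 0 < κ) (hN : 1 ≤ N) (hNM : N ≤ M)
    (hq : ∀ n, N ≤ n → n < M → q n = (κ + F n) / n) (hF : ∀ n, |F n| ≤ F₀)
    (hA : ‖∑ n ∈ Finset.Ico N M, (1 / n : ℂ) * (p n * r n * p n * A n)‖ ≤ ε)
    (hA' : ‖∑ n ∈ Finset.Ico N M,
      (1 / n : ℂ) * (p n * r n * starRingEnd ℂ (p n) * starRingEnd ℂ (A n))‖ ≤ ε)
    (hB : ‖∑ n ∈ Finset.Ico N M, (1 / n : ℂ) * (p n * r n * r n * B n)‖ ≤ ε)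
    (hB' : ‖∑ n ∈ Finset.Ico N M,
      (1 / n : ℂ) * (p n * r n * starRingEnd ℂ (r n) * starRingEnd ℂ (B n))‖ ≤ ε) :
    ‖∑ n ∈ Finset.Ico N M, (1 / n : ℂ) * (p n * r n * ((s * ‖A n‖ + s' * ‖B n‖ : ℝ) : ℂ))‖ ≤
      2 * ε + (2 + 4 * F₀ * a * ∑ n ∈ Finset.Ico N M, (1 / n : ℝ)
        + 48 * ((κ + F₀) * a) ^ 2 / N) / κ := by
  have ha : 0 ≤ a := (norm_nonneg _).trans (hp.norm_coeff_le 0)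
  -- E is what remains of the increment of p r after removing only the part driven by κ: the
  -- feedback F stays in the error.
  set E : ℕ → ℂ := fun n => p (n + 1) * r (n + 1) - p n * r n
    - Complex.I * (q n : ℂ) * (p n * r n) *
      ((s * (‖A n‖ - (p n * A n).re) + s' * (‖B n‖ - (r n * B n).re) : ℝ) : ℂ)
    + Complex.I * (F n / n : ℂ) * (p n * r n) *
      ((s * (‖A n‖ - (p n * A n).re) + s' * (‖B n‖ - (r n * B n).re) : ℝ) : ℂ) with hE
  have hκC : (κ : ℂ) ≠ 0 := by exact_mod_cast hκ.ne'
  have hEb : ∀ n ∈ Finset.Ico N M, ‖E n‖ ≤ 4 * F₀ * a * (1 / n)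
      + 24 * ((κ + F₀) * a) ^ 2 * (1 / (n : ℝ) ^ 2) := by
    intro n hn
    rw [Finset.mem_Ico] at hn
    have hn0 : (0 : ℝ) < n := by exact_mod_cast (by omega : 0 < n)
    rw [hE]
    refine (norm_add_le _ _).trans ?_
    rw [add_comm]
    refine add_le_add ?_ ((hp.mul hr hn.1 hn.2).trans ?_)
    · rw [norm_mul, norm_mul, norm_mul, Complex.norm_I, one_mul, norm_div, Complex.norm_natCast,
        Complex.norm_real, Complex.norm_real, Real.norm_eq_abs, Real.norm_eq_abs]
      have b1 : |s * (‖A n‖ - (p n * A n).re) + s' * (‖B n‖ - (r n * B n).re)| ≤ 4 * a := by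
        refine (abs_add_le _ _).trans ?_
        have := hp.abs_rate_le n
        have := hr.abs_rate_le n
        linarith
      have b2 : ‖p n * r n‖ ≤ 1 := by
        rw [norm_mul]; exact mul_le_one₀ (hp.norm_le n) (norm_nonneg _) (hr.norm_le n)
      calc |F n| / n * ‖p n * r n‖ * _ ≤ F₀ / n * 1 * (4 * a) := by
            have := (abs_nonneg _).trans (hF n)
            gcongr
            exact hF n
        _ = _ := by ring
    · have b : |q n| ≤ (κ + F₀) / n := by
        rw [hq n hn.1 hn.2, abs_div, Nat.abs_cast]
        gcongr
        refine (abs_add_le _ _).trans ?_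
        rw [abs_of_pos hκ]
        linarith [hF n]
      calc 24 * (|q n| * a) ^ 2 ≤ 24 * ((κ + F₀) / n * a) ^ 2 := by gcongr
        _ = _ := by ring
  -- The phase equation is solved for the rotation term: the real parts become four sums controlled
  -- by hypothesis, and the increment of p r telescopes to at most 2, gaining the factor 1 / κ.
  have hid : ∀ n ∈ Finset.Ico N M,
      (1 / n : ℂ) * (p n * r n * ((s * ‖A n‖ + s' * ‖B n‖ : ℝ) : ℂ))
      = (s / 2) * ((1 / n : ℂ) * (p n * r n * p n * A n)
          + (1 / n : ℂ) * (p n * r n * starRingEnd ℂ (p n) * starRingEnd ℂ (A n)))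
        + (s' / 2) * ((1 / n : ℂ) * (p n * r n * r n * B n)
          + (1 / n : ℂ) * (p n * r n * starRingEnd ℂ (r n) * starRingEnd ℂ (B n)))
        + (-Complex.I / κ) * ((p (n + 1) * r (n + 1) - p n * r n) - E n) := by
    intro n hn
    rw [Finset.mem_Ico] at hn
    have hn0 : (n : ℂ) ≠ 0 := by exact_mod_cast (by omega : n ≠ 0)
    have hre : ∀ x : ℂ, ((x.re : ℝ) : ℂ) = (x + starRingEnd ℂ x) / 2 := fun x => by
      rw [Complex.add_conj]
      push_cast
      ring
    rw [hE]
    simp only [hq n hn.1 hn.2]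
    push_cast
    rw [hre, hre, map_mul, map_mul]
    field_simp
    ring_nf
    simp only [Complex.I_sq]
    ring
  have htel : ∑ n ∈ Finset.Ico N M, (p (n + 1) * r (n + 1) - p n * r n)
      = p M * r M - p N * r N := Finset.sum_Ico_sub (fun n => p n * r n) hNM
  rw [Finset.sum_congr rfl hid]
  simp only [Finset.sum_add_distrib, ← Finset.mul_sum, Finset.sum_sub_distrib, htel]
  have hsn : ∀ σ : ℝ, |σ| = 1 → ‖(σ / 2 : ℂ)‖ = 1 / 2 := fun σ h => by
    rw [norm_div, Complex.norm_real, Real.norm_eq_abs, h, Complex.norm_two]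
  have hpr : ∀ n, ‖p n * r n‖ ≤ 1 := fun n => by
    rw [norm_mul]; exact mul_le_one₀ (hp.norm_le n) (norm_nonneg _) (hr.norm_le n)
  refine norm_add₃_le.trans ?_
  rw [norm_mul, norm_mul, norm_mul, hsn s hp.abs_sign, hsn s' hr.abs_sign, norm_div, norm_neg,
    Complex.norm_I, Complex.norm_real, Real.norm_eq_abs, abs_of_pos hκ]
  have c1 := (norm_add_le _ _).trans (add_le_add hA hA')
  have c2 := (norm_add_le _ _).trans (add_le_add hB hB')
  have c3 : ‖p M * r M - p N * r N - ∑ n ∈ Finset.Ico N M, E n‖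
      ≤ 2 + 4 * F₀ * a * ∑ n ∈ Finset.Ico N M, (1 / n : ℝ) + 48 * ((κ + F₀) * a) ^ 2 / N := by
    refine (_root_.norm_sub_le _ _).trans ?_
    have d1 := (_root_.norm_sub_le (p M * r M) (p N * r N)).trans (add_le_add (hpr M) (hpr N))
    have d2 : ‖∑ n ∈ Finset.Ico N M, E n‖ ≤ 4 * F₀ * a * ∑ n ∈ Finset.Ico N M, (1 / n : ℝ)
        + 24 * ((κ + F₀) * a) ^ 2 * ∑ n ∈ Finset.Ico N M, (1 / (n : ℝ) ^ 2) := by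
      rw [Finset.mul_sum, Finset.mul_sum, ← Finset.sum_add_distrib]
      exact (norm_sum_le _ _).trans (Finset.sum_le_sum hEb)
    have d3 := mul_le_mul_of_nonneg_left (sum_Ico_one_div_sq_le hN hNM)
      (show 0 ≤ 24 * ((κ + F₀) * a) ^ 2 by positivity)
    have : 24 * ((κ + F₀) * a) ^ 2 * (2 / (N : ℝ)) = 48 * ((κ + F₀) * a) ^ 2 / N := by ring
    linarith
  have c4 := mul_le_mul_of_nonneg_left c3 (show 0 ≤ 1 / κ by positivity)
  rw [one_div_mul_eq_div κ (2 + _ + _)] at c4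
  linarith

end PhaseEquation

/-! ### Averages of products of two squared Floquet solutions -/

/-- The sequence `g` is the sum of a bounded coboundary, the constant `ν` and a multiple of `d`. -/
def AveragesTo (d : ℕ → ℝ) (g : ℕ → ℂ) (ν : ℂ) : Prop :=
  ∃ (H : ℕ → ℂ) (μ : ℂ), (∃ E, ∀ n, ‖H n‖ ≤ E) ∧ ∀ n, g n = H (n + 1) - H n + ν + μ * (d n : ℂ)

theorem averagesTo_zero_of_multiplier {T : ℕ} (hT : 0 < T) {d : ℕ → ℝ} {g : ℕ → ℂ} {y : ℂ}
    (hg : ∀ n, g (n + T) = y * g n) (hy : ‖y‖ = 1) (hy1 : y ≠ 1) : AveragesTo d g 0 := by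
  obtain ⟨E, hE⟩ := exists_norm_bound_of_multiplier hT hg hy
  obtain ⟨H, hH, h⟩ := exists_primitive_of_multiplier hg hy1 hE
  exact ⟨H, 0, hH, fun n => by rw [h n]; ring⟩

theorem averagesTo_mean_of_periodic {T : ℕ} (hT : 0 < T) {d : ℕ → ℝ} {g : ℕ → ℂ}
    (hg : ∀ n, g (n + T) = g n) : AveragesTo d g ((∑ m ∈ Finset.range T, g m) / T) := by
  obtain ⟨H, hH, h⟩ := exists_primitive_of_periodic hT hg
  exact ⟨H, 0, hH, fun n => by rw [h n]; ring⟩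

/-- A multiple of d with the same mean as g absorbs that mean; what is left is a periodic sequence
of mean zero. -/
theorem averagesTo_zero_of_drift {T : ℕ} (hT : 0 < T) {d : ℕ → ℝ} {g : ℕ → ℂ}
    (hg : ∀ n, g (n + T) = g n) (hd : ∀ n, d (n + T) = d n)
    (hd0 : ∑ m ∈ Finset.range T, d m ≠ 0) : AveragesTo d g 0 := by
  obtain ⟨H, ⟨E, hE⟩, h⟩ := exists_primitive_of_periodic hT hg
  obtain ⟨H', ⟨E', hE'⟩, h'⟩ := exists_primitive_of_periodic (g := fun n => (d n : ℂ)) hT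
    (fun n => by rw [hd])
  set ν := (∑ m ∈ Finset.range T, g m) / (T : ℂ)
  set δ := (∑ m ∈ Finset.range T, (d m : ℂ)) / (T : ℂ) with hδ
  have hδ0 : δ ≠ 0 := by
    rw [hδ, ← Complex.ofReal_sum]
    exact div_ne_zero (by exact_mod_cast hd0) (by exact_mod_cast hT.ne')
  refine ⟨fun n => H n - ν / δ * H' n, ν / δ, ⟨E + ‖ν / δ‖ * E', fun n => ?_⟩, fun n => ?_⟩
  · refine (norm_sub_le _ _).trans (add_le_add (hE n) ?_)
    rw [norm_mul]
    gcongr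
    exact hE' n
  · rw [h n, h' n]
    field_simp
    ring

/-- Cauchy–Schwarz over one period, strict because equality would force proportionality. -/
theorem norm_sum_mul_conj_lt {T : ℕ} {x y : ℕ → ℂ} (hx : ∃ n < T, x n ≠ 0) (hy : ∃ n < T, y n ≠ 0)
    (h : ∀ z : ℂ, ∃ n < T, x n ≠ z * y n) :
    ‖∑ n ∈ Finset.range T, x n * starRingEnd ℂ (y n)‖ <
      √(∑ n ∈ Finset.range T, ‖x n‖ ^ 2) * √(∑ n ∈ Finset.range T, ‖y n‖ ^ 2) := by
  set X : EuclideanSpace ℂ (Fin T) := WithLp.toLp 2 fun n => x n with hX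
  set Y : EuclideanSpace ℂ (Fin T) := WithLp.toLp 2 fun n => y n with hY
  have hin : ∑ n ∈ Finset.range T, x n * starRingEnd ℂ (y n) = inner ℂ Y X := by
    rw [PiLp.inner_apply, Finset.sum_range]
    simp [hX, hY]
  have hXn : √(∑ n ∈ Finset.range T, ‖x n‖ ^ 2) = ‖X‖ := by
    rw [EuclideanSpace.norm_eq, Finset.sum_range]
  have hYn : √(∑ n ∈ Finset.range T, ‖y n‖ ^ 2) = ‖Y‖ := by
    rw [EuclideanSpace.norm_eq, Finset.sum_range]
  have hX0 : X ≠ 0 := by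
    obtain ⟨n, hn, h0⟩ := hx
    intro h; exact h0 (by simpa [hX] using congrArg (fun v : EuclideanSpace ℂ (Fin T) => v ⟨n, hn⟩) h)
  have hY0 : Y ≠ 0 := by
    obtain ⟨n, hn, h0⟩ := hy
    intro h; exact h0 (by simpa [hY] using congrArg (fun v : EuclideanSpace ℂ (Fin T) => v ⟨n, hn⟩) h)
  rw [hin, hXn, hYn, mul_comm]
  refine lt_of_le_of_ne (norm_inner_le_norm _ _) fun he => ?_
  obtain ⟨z, -, hz⟩ := (norm_inner_eq_norm_iff hY0 hX0).1 he
  obtain ⟨n, hn, h1⟩ := h z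
  exact h1 (by simpa [hX, hY] using congrArg (fun v : EuclideanSpace ℂ (Fin T) => v ⟨n, hn⟩) hz)

/-- The averages of `A` times `conj B`, unless `A` is a unimodular multiple of `B`. -/
theorem exists_averagesTo_mul_conj {T : ℕ} (hT : 0 < T) {A B : ℕ → ℂ} {x y : ℂ}
    (hA : ∀ n, A (n + T) = x * A n) (hB : ∀ n, B (n + T) = y * B n) (hx : ‖x‖ = 1) (hy : ‖y‖ = 1)
    (hA0 : A 0 ≠ 0) (hB0 : B 0 ≠ 0) (hpar : ∀ z : ℂ, ‖z‖ = 1 → ∃ n, A n ≠ z * B n) :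
    ∃ ν : ℂ, ‖ν‖ < √((∑ m ∈ Finset.range T, ‖A m‖ ^ 2) / T) * √((∑ m ∈ Finset.range T, ‖B m‖ ^ 2) / T) ∧
      (x ≠ y → ν = 0) ∧
      AveragesTo (fun n => 1 * ‖A n‖ + -1 * ‖starRingEnd ℂ (B n)‖)
        (fun n => A n * starRingEnd ℂ (B n)) ν := by
  have hTR : (0 : ℝ) < T := by exact_mod_cast hT
  have hpos : ∀ C : ℕ → ℂ, C 0 ≠ 0 → 0 < ∑ m ∈ Finset.range T, ‖C m‖ ^ 2 := fun C hC =>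
    (pow_pos (norm_pos_iff.2 hC) 2).trans_le (Finset.single_le_sum (f := fun m => ‖C m‖ ^ 2)
      (fun _ _ => by positivity) (Finset.mem_range.2 hT))
  have hpos' : 0 < √((∑ m ∈ Finset.range T, ‖A m‖ ^ 2) / T) *
      √((∑ m ∈ Finset.range T, ‖B m‖ ^ 2) / T) := by
    have := hpos A hA0
    have := hpos B hB0
    positivity
  have hg : ∀ n, A (n + T) * starRingEnd ℂ (B (n + T))
      = x * starRingEnd ℂ y * (A n * starRingEnd ℂ (B n)) := fun n => by
    rw [hA, hB, map_mul]; ring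
  have hyy : y * starRingEnd ℂ y = 1 := by
    rw [Complex.mul_conj, Complex.normSq_eq_norm_sq, hy]; simp
  by_cases hxy : x = y
  · subst hxy
    have hg' : ∀ n, A (n + T) * starRingEnd ℂ (B (n + T)) = A n * starRingEnd ℂ (B n) :=
      fun n => by rw [hg, hyy, one_mul]
    -- In resonance, proportional sequences have |z| ≠ 1, so |A| - |B| has non-zero mean and serves
    -- as the drift; otherwise the mean itself is kept and bounded by strict Cauchy–Schwarz.
    by_cases hz : ∃ z : ℂ, ∀ n < T, A n = z * B n
    · obtain ⟨z, hz⟩ := hz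
      have hall : ∀ n, A n = z * B n := by
        intro n
        induction n using Nat.strong_induction_on with
        | _ n ih =>
          rcases lt_or_ge n T with h | h
          · exact hz n h
          · obtain ⟨k, rfl⟩ := Nat.exists_eq_add_of_le' h
            rw [hA, hB, ih k (by omega)]; ring
      have hz1 : ‖z‖ ≠ 1 := fun h1 => by
        obtain ⟨n, hn⟩ := hpar z h1
        exact hn (hall n)
      refine ⟨0, by simpa using hpos', fun _ => rfl, averagesTo_zero_of_drift hT hg' (fun n => ?_) ?_⟩
      · simp only [hA, hB, RCLike.norm_conj, norm_mul, hx, one_mul]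
      · have : ∀ m, 1 * ‖A m‖ + -1 * ‖starRingEnd ℂ (B m)‖ = (‖z‖ - 1) * ‖B m‖ := fun m => by
          rw [RCLike.norm_conj, hall, norm_mul]; ring
        simp only [this]
        rw [← Finset.mul_sum]
        refine mul_ne_zero (sub_ne_zero.2 hz1) (ne_of_gt ?_)
        exact (norm_pos_iff.2 hB0).trans_le (Finset.single_le_sum (f := fun m => ‖B m‖)
          (fun _ _ => norm_nonneg _) (Finset.mem_range.2 hT))
    · push Not at hz
      refine ⟨_, ?_, fun h => absurd rfl h, averagesTo_mean_of_periodic hT hg'⟩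
      have h1 := norm_sum_mul_conj_lt ⟨0, hT, hA0⟩ ⟨0, hT, hB0⟩ hz
      rw [Real.sqrt_div' _ hTR.le, Real.sqrt_div' _ hTR.le, div_mul_div_comm,
        Real.mul_self_sqrt hTR.le, norm_div, Complex.norm_natCast]
      gcongr
  · refine ⟨0, by simpa using hpos', fun _ => rfl, averagesTo_zero_of_multiplier hT hg ?_ ?_⟩
    · rw [norm_mul, RCLike.norm_conj, hx, hy, one_mul]
    · intro h
      apply hxy
      linear_combination y * h - x * hyy

/-- No mean survives here, even for A = B: the rate |A| + |B| has positive mean, so drift is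
available at every resonance. -/
theorem averagesTo_mul {T : ℕ} (hT : 0 < T) {A B : ℕ → ℂ} {x y : ℂ}
    (hA : ∀ n, A (n + T) = x * A n) (hB : ∀ n, B (n + T) = y * B n) (hx : ‖x‖ = 1) (hy : ‖y‖ = 1)
    (hA0 : A 0 ≠ 0) :
    AveragesTo (fun n => 1 * ‖A n‖ + 1 * ‖B n‖) (fun n => A n * B n) 0 := by
  have hg : ∀ n, A (n + T) * B (n + T) = x * y * (A n * B n) := fun n => by
    rw [hA, hB]; ring
  by_cases hxy : x * y = 1
  · refine averagesTo_zero_of_drift hT (fun n => by rw [hg, hxy, one_mul]) (fun n => ?_) (ne_of_gt ?_)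
    · simp only [hA, hB, norm_mul, hx, hy, one_mul]
    · have h0 := norm_pos_iff.2 hA0
      exact (show 0 < 1 * ‖A 0‖ + 1 * ‖B 0‖ by positivity).trans_le
        (Finset.single_le_sum (f := fun m => 1 * ‖A m‖ + 1 * ‖B m‖)
          (fun _ _ => by positivity) (Finset.mem_range.2 hT))
  · exact averagesTo_zero_of_multiplier hT hg (by rw [norm_mul, hx, hy, one_mul]) hxy

/-- For potentials `(κ + F n) / n` with `|F n| ≤ F₀`, the logarithmic averages of `g` times a
product of two phases are at most `b` up to `ε`, from `N` on. -/
def PhaseSumBound (A B g : ℕ → ℂ) (s s' a F₀ ε b κ : ℝ) (N : ℕ) : Prop :=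
  ∀ M, N ≤ M → ∀ (q F : ℕ → ℝ) (p r : ℕ → ℂ),
    PhaseEquation q a s A N M p → PhaseEquation q a s' B N M r →
    (∀ n, N ≤ n → n < M → q n = (κ + F n) / n) → (∀ n, |F n| ≤ F₀) →
    ‖∑ n ∈ Finset.Ico N M, (1 / n : ℂ) * (p n * r n * g n)‖ ≤
      (b + ε) * ∑ n ∈ Finset.Ico N M, (1 / n : ℝ) + ε

/-- The three parts of g are treated separately: the coboundary by summation by parts, ν trivially,
and the multiple of the rate by `norm_drift_sum_le`. The drift κ is fixed before N, because the
quadratic errors grow with κ and decay only in N. -/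
theorem eventually_phaseSumBound {A B g : ℕ → ℂ} {s s' a F₀ ε : ℝ} {ν : ℂ}
    (hA : AveragesTo 0 A 0) (hB : AveragesTo 0 B 0)
    (hg : AveragesTo (fun n => s * ‖A n‖ + s' * ‖B n‖) g ν) (ha : 0 ≤ a) (hF₀ : 0 ≤ F₀)
    (hε : 0 < ε) :
    ∀ᶠ κ : ℝ in atTop, ∀ᶠ N : ℕ in atTop, PhaseSumBound A B g s s' a F₀ ε ‖ν‖ κ N := by
  obtain ⟨HA, μA, ⟨EA, hEA⟩, hA⟩ := hA
  obtain ⟨HB, μB, ⟨EB, hEB⟩, hB⟩ := hB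
  obtain ⟨H, μ, hH, hg⟩ := hg
  simp only [Pi.zero_apply, Complex.ofReal_zero, mul_zero, add_zero] at hA hB
  have hlim : ∀ c : ℝ, Tendsto (fun κ : ℝ => c / κ) atTop (𝓝 0) := fun c =>
    tendsto_const_nhds.div_atTop tendsto_id
  filter_upwards [eventually_gt_atTop 0,
    (hlim (‖μ‖ * (4 * F₀ * a))).eventually (ge_mem_nhds hε),
    (hlim (‖μ‖ * 2)).eventually (ge_mem_nhds (show 0 < ε / 4 by positivity))] with κ hκ hκ1 hκ2
  -- One sum enters with factor 1 and others with total factor 2‖μ‖; together they cost ε / 4.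
  set ε₁ := ε / (4 * (1 + 2 * ‖μ‖)) with hε₁
  have hε₁p : 0 < ε₁ := by positivity
  have hε₁e : ε₁ * (1 + 2 * ‖μ‖) = ε / 4 := by rw [hε₁]; field_simp
  set D := 4 * ((κ + F₀) * a) with hD
  have hD0 : 0 ≤ D := by positivity
  have hstar : ∀ G : ℕ → ℂ, (∀ n, starRingEnd ℂ (G (n + 1) - G n)
      = (fun m => starRingEnd ℂ (G m)) (n + 1) - (fun m => starRingEnd ℂ (G m)) n) :=
    fun G n => map_sub _ _ _
  have hlimN : Tendsto (fun N : ℕ => ‖μ‖ * (48 * ((κ + F₀) * a) ^ 2 / κ) / N) atTop (𝓝 0) :=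
    tendsto_const_div_atTop_nhds_zero_nat _
  filter_upwards [eventually_ge_atTop 1,
    hlimN.eventually (ge_mem_nhds (show 0 < ε / 4 by positivity)),
    eventually_norm_sum_le (D := D + D) hH (by positivity) hε₁p,
    eventually_norm_sum_le (D := D + D + D) ⟨EA, hEA⟩ (by positivity) hε₁p,
    eventually_norm_sum_le (D := D + D + D) ⟨EB, hEB⟩ (by positivity) hε₁p,
    eventually_norm_sum_le (H := fun m => starRingEnd ℂ (HA m)) (D := D + D + D)
      ⟨EA, fun n => by simpa using hEA n⟩ (by positivity) hε₁p,
    eventually_norm_sum_le (H := fun m => starRingEnd ℂ (HB m)) (D := D + D + D)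
      ⟨EB, fun n => by simpa using hEB n⟩ (by positivity) hε₁p]
    with N hN hN2 e1 e2 e3 e4 e5 M hM q F p r hp hr hq hF
  have hqD : ∀ n, N ≤ n → n < M → |q n| ≤ (κ + F₀) / n := fun n h1 h2 => by
    rw [hq n h1 h2, abs_div, Nat.abs_cast]
    gcongr
    refine (abs_add_le _ _).trans ?_
    rw [abs_of_pos hκ]
    linarith [hF n]
  have sp := hp.slowlyVarying hqD
  have sr := hr.slowlyVarying hqD
  have hdrift := hp.norm_drift_sum_le hr hκ hN hM hq hF (ε := ε₁)
    (by simp only [hA]; exact e2 M hM _ ((sp.mul sr).mul sp))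
    (by simp only [hA, hstar]; exact e4 M hM _ ((sp.mul sr).mul sp.star))
    (by simp only [hB]; exact e3 M hM _ ((sp.mul sr).mul sr))
    (by simp only [hB, hstar]; exact e5 M hM _ ((sp.mul sr).mul sr.star))
  have h1 := e1 M hM _ (sp.mul sr)
  have hS : 0 ≤ ∑ n ∈ Finset.Ico N M, (1 / n : ℝ) := Finset.sum_nonneg fun _ _ => by positivity
  have h2 : ‖∑ n ∈ Finset.Ico N M, (1 / n : ℂ) * (p n * r n)‖
      ≤ ∑ n ∈ Finset.Ico N M, (1 / n : ℝ) := by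
    refine (norm_sum_le _ _).trans (Finset.sum_le_sum fun n _ => ?_)
    rw [norm_mul, norm_div, norm_one, Complex.norm_natCast]
    exact mul_le_of_le_one_right (by positivity) ((sp.mul sr).norm_le n)
  have hsplit : ∑ n ∈ Finset.Ico N M, (1 / n : ℂ) * (p n * r n * g n)
      = (∑ n ∈ Finset.Ico N M, (1 / n : ℂ) * (p n * r n * (H (n + 1) - H n)))
        + ν * (∑ n ∈ Finset.Ico N M, (1 / n : ℂ) * (p n * r n))
        + μ * ∑ n ∈ Finset.Ico N M,
            (1 / n : ℂ) * (p n * r n * ((s * ‖A n‖ + s' * ‖B n‖ : ℝ) : ℂ)) := by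
    rw [Finset.mul_sum, Finset.mul_sum, ← Finset.sum_add_distrib, ← Finset.sum_add_distrib]
    refine Finset.sum_congr rfl fun n _ => ?_
    rw [hg n]; ring
  rw [hsplit]
  refine norm_add₃_le.trans ?_
  rw [norm_mul, norm_mul]
  have h3 := mul_le_mul_of_nonneg_left h2 (norm_nonneg ν)
  have h4 := mul_le_mul_of_nonneg_left hdrift (norm_nonneg μ)
  have h5 := mul_le_mul_of_nonneg_right hκ1 hS
  have h6 : ‖μ‖ * (2 * ε₁ + (2 + 4 * F₀ * a * ∑ n ∈ Finset.Ico N M, (1 / n : ℝ)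
        + 48 * ((κ + F₀) * a) ^ 2 / N) / κ)
      = 2 * ‖μ‖ * ε₁ + ‖μ‖ * 2 / κ
        + ‖μ‖ * (4 * F₀ * a) / κ * ∑ n ∈ Finset.Ico N M, (1 / n : ℝ)
        + ‖μ‖ * (48 * ((κ + F₀) * a) ^ 2 / κ) / N := by
    field_simp
    ring
  rw [h6] at h4
  linarith

/-! ### Feedback control of finitely many solutions -/

/-- The decaying potential: a drift `κ` and a feedback against the growth of the solutions in `I`,
divided by `n`. -/
noncomputable def feedbackPotential {ι : Type*} (I : Finset ι) (c : ι → ℝ) (κ : ℝ) (ψ : ι → ℕ → ℂ) (n : ℕ)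
    (z : ι → ℂ) : ℝ :=
  (κ + ∑ i ∈ I, c i * (sqPhase (z i) * ψ i n ^ 2).im) / n

/-- The coefficients `Z i` for `i ∈ I` evolve on `[N, M)` under the potential `feedbackPotential`. -/
structure IsControlled {ι : Type*} (I : Finset ι) (c : ι → ℝ) (κ : ℝ) (ψ : ι → ℕ → ℂ) (N M : ℕ)
    (Z : ι → ℕ → ℂ) : Prop where
  ne_zero : ∀ i ∈ I, Z i N ≠ 0
  step : ∀ i ∈ I, ∀ n, N ≤ n → n < M →
    Z i (n + 1) = kick (feedbackPotential I c κ ψ n fun j => Z j n) (ψ i n) (Z i n)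

theorem norm_sq_le_of_kick {q : ℕ → ℝ} {v z : ℕ → ℂ} {N M : ℕ} (hNM : N ≤ M)
    (h : ∀ n, N ≤ n → n < M → z (n + 1) = kick (q n) (v n) (z n)) :
    ‖z M‖ ^ 2 ≤ ‖z N‖ ^ 2 * Real.exp (∑ n ∈ Finset.Ico N M,
      (-(q n * (sqPhase (z n) * v n ^ 2).im) + (q n * ‖v n ^ 2‖) ^ 2)) := by
  induction M, hNM using Nat.le_induction with
  | base => simp
  | succ k hk ih =>
    have ih := ih fun n h1 h2 => h n h1 (by omega)
    rw [Finset.sum_Ico_succ_top hk, Real.exp_add, ← mul_assoc, h k hk (by omega)]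
    exact (norm_kick_sq_le _ _ _).trans (mul_le_mul_of_nonneg_right ih (Real.exp_pos _).le)

theorem ne_zero_of_kick {q : ℕ → ℝ} {v z : ℕ → ℂ} {N M : ℕ} (hz : z N ≠ 0)
    (h : ∀ n, N ≤ n → n < M → z (n + 1) = kick (q n) (v n) (z n)) :
    ∀ n, N ≤ n → n ≤ M → z n ≠ 0 := by
  intro n hn
  induction n, hn using Nat.le_induction with
  | base => exact fun _ => hz
  | succ k hk ih =>
    intro hM
    rw [h k hk (by omega)]
    exact kick_ne_zero (ih (by omega))

theorem phaseEquation_of_kick {q : ℕ → ℝ} {v z : ℕ → ℂ} {N M : ℕ} {a : ℝ} (hz : z N ≠ 0)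
    (h : ∀ n, N ≤ n → n < M → z (n + 1) = kick (q n) (v n) (z n))
    (hv : ∀ n, ‖v n ^ 2‖ ≤ a) (hq : ∀ n, N ≤ n → n < M → |q n| * a ≤ 1 / 2) :
    PhaseEquation q a 1 (fun n => v n ^ 2) N M fun n => sqPhase (z n) := by
  refine ⟨fun n => norm_sqPhase_le _, hv, hq, abs_one, fun n h1 h2 => ?_⟩
  have h3 : |q n| * ‖v n ^ 2‖ ≤ |q n| * a := mul_le_mul_of_nonneg_left (hv n) (abs_nonneg _)
  have h4 := norm_sqPhase_kick_sub_le (ne_zero_of_kick hz h n h1 h2.le) (h3.trans (hq n h1 h2))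
  simp only [one_mul]
  rw [h n h1 h2]
  refine h4.trans ?_
  gcongr

/-- With c i = G / r i the diagonal term is G r_l. By uniqueness of the resonant partner the sum has
at most one non-zero term, which is at most η G r_l for a common η < 1. The gap (1 - η) G r_l is
made at least 4 by the choice of G. -/
theorem exists_weights {ι : Type*} [DecidableEq ι] (I : Finset ι) {r : ι → ℝ} {ρ : ι → ι → ℝ}
    (hr : ∀ i, 0 < r i) (hρ : ∀ i l, i ≠ l → ρ i l < r i * r l)
    (huniq : ∀ i j l, i ≠ l → j ≠ l → ρ i l ≠ 0 → ρ j l ≠ 0 → i = j) :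
    ∃ c : ι → ℝ, (∀ i, 0 < c i) ∧
      ∀ l ∈ I, 4 ≤ c l * r l ^ 2 - ∑ i ∈ I.erase l, c i * ρ i l := by
  have h1 : ∀ᶠ η : ℝ in 𝓝[<] 1, ∀ i ∈ I, ∀ l ∈ I, i ≠ l → ρ i l ≤ η * (r i * r l) := by
    refine (eventually_all_finset I).2 fun i _ => (eventually_all_finset I).2 fun l _ => ?_
    by_cases hil : i = l
    · exact Eventually.of_forall fun η h => absurd hil h
    · have hc : ContinuousAt (fun η : ℝ => η * (r i * r l)) 1 := by fun_prop
      have := hc.eventually (lt_mem_nhds (show ρ i l < 1 * (r i * r l) by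
        rw [one_mul]; exact hρ i l hil))
      filter_upwards [nhdsWithin_le_nhds this] with η h _ using h.le
  have h2 : ∀ᶠ r₀ : ℝ in 𝓝[>] 0, ∀ i ∈ I, r₀ ≤ r i := by
    refine (eventually_all_finset I).2 fun i _ => ?_
    filter_upwards [nhdsWithin_le_nhds (gt_mem_nhds (hr i))] with x hx using hx.le
  obtain ⟨η, hη, hη1, hη0⟩ := (h1.and (eventually_mem_nhdsWithin.and
    (nhdsWithin_le_nhds (lt_mem_nhds (zero_lt_one' ℝ))))).exists
  obtain ⟨r₀, hr₀, hr₀p⟩ := (h2.and eventually_mem_nhdsWithin).exists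
  have hη1 : 0 < 1 - η := sub_pos.2 hη1
  have hr₀p : 0 < r₀ := hr₀p
  set G := 4 / ((1 - η) * r₀) with hG
  have hGp : 0 < G := by positivity
  refine ⟨fun i => G / r i, fun i => div_pos hGp (hr i), fun l hl => ?_⟩
  have hsum : ∑ i ∈ I.erase l, G / r i * ρ i l ≤ G * η * r l := by
    have hnn : 0 ≤ G * η * r l := by have := hr l; positivity
    by_cases hex : ∃ i ∈ I.erase l, ρ i l ≠ 0
    · obtain ⟨i, hi, hi0⟩ := hex
      rw [Finset.mem_erase] at hi
      rw [Finset.sum_eq_single_of_mem i (Finset.mem_erase.2 hi)]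
      · have := hη i hi.2 l hl hi.1
        have hri := hr i
        calc G / r i * ρ i l ≤ G / r i * (η * (r i * r l)) := by gcongr
          _ = _ := by field_simp
      · intro j hj hji
        by_contra h0
        exact hji (huniq j i l (Finset.ne_of_mem_erase hj) hi.1 (right_ne_zero_of_mul h0) hi0)
    · push Not at hex
      rw [Finset.sum_eq_zero fun i hi => by rw [hex i hi, mul_zero]]
      exact hnn
  have e1 : G / r l * r l ^ 2 = G * r l := by have := (hr l).ne'; field_simp
  have e2 : G * ((1 - η) * r₀) = 4 := by rw [hG]; field_simp
  have e3 : G * ((1 - η) * r₀) ≤ G * ((1 - η) * r l) := by gcongr; exact hr₀ l hl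
  rw [e1]
  linarith

theorem im_mul_im (x y : ℂ) :
    x.im * y.im = (x * starRingEnd ℂ y).re / 2 - (x * y).re / 2 := by
  simp [Complex.mul_re]
  ring

/-- For a finite family of Floquet solutions, of which at most two at a time are in resonance, a
feedback potential of size `D / n` makes all coefficients decay like `n ^ (-3/4)`. -/
theorem exists_feedbackPotential {ι : Type*} [DecidableEq ι] (I : Finset ι) {T : ℕ} (hT : 0 < T)
    {ψ : ι → ℕ → ℂ} {ξ : ι → ℂ} (hψ : ∀ i n, ψ i (n + T) = ξ i * ψ i n) (hψ0 : ∀ i, ψ i 0 ≠ 0)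
    (hξ : ∀ i, ‖ξ i‖ = 1) (hξ2 : ∀ i, ξ i ^ 2 ≠ 1)
    (huniq : ∀ i j l, i ≠ l → j ≠ l → ξ i ^ 2 = ξ l ^ 2 → ξ j ^ 2 = ξ l ^ 2 → i = j)
    (hpar : ∀ i l, i ≠ l → ∀ z : ℂ, ‖z‖ = 1 → ∃ n, ψ i n ^ 2 ≠ z * ψ l n ^ 2)
    {δ : ℝ} (hδ : 0 < δ) :
    ∃ (c : ι → ℝ) (κ D : ℝ) (N₀ : ℕ), (∀ n z, |feedbackPotential I c κ ψ n z| ≤ D / n) ∧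
      ∀ N, N₀ ≤ N → ∀ M, N ≤ M → ∀ Z, IsControlled I c κ ψ N M Z → ∀ l ∈ I,
        ‖Z l M‖ ^ 2 ≤ ‖Z l N‖ ^ 2 *
          Real.exp (-(3 / 2) * ∑ n ∈ Finset.Ico N M, (1 / n : ℝ) + δ) := by
  set A : ι → ℕ → ℂ := fun i n => ψ i n ^ 2 with hAdef
  have hA : ∀ i n, A i (n + T) = ξ i ^ 2 * A i n := fun i n => by
    simp only [hAdef, hψ, mul_pow]
  have hA0 : ∀ i, A i 0 ≠ 0 := fun i => pow_ne_zero 2 (hψ0 i)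
  have hx : ∀ i, ‖ξ i ^ 2‖ = 1 := fun i => by rw [norm_pow, hξ, one_pow]
  choose E hE using fun i => exists_norm_bound_of_multiplier hT (hA i) (hx i)
  obtain ⟨a', ha'⟩ := (I.image E).exists_le
  set a := max a' 1 with ha_def
  have ha : ∀ i ∈ I, ∀ n, ‖A i n‖ ≤ a := fun i hi n =>
    (hE i n).trans ((ha' _ (Finset.mem_image_of_mem _ hi)).trans (le_max_left _ _))
  have ha1 : 1 ≤ a := le_max_right _ _
  have hav : ∀ i, AveragesTo 0 (A i) 0 := fun i =>
    averagesTo_zero_of_multiplier hT (hA i) (hx i) (hξ2 i)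
  have havc : ∀ i, AveragesTo 0 (fun n => starRingEnd ℂ (A i n)) 0 := fun i => by
    refine averagesTo_zero_of_multiplier hT (y := starRingEnd ℂ (ξ i ^ 2)) (fun n => ?_) ?_ ?_
    · rw [hA, map_mul]
    · rw [RCLike.norm_conj, hx]
    · intro h
      apply hξ2 i
      have := congrArg (starRingEnd ℂ) h
      rwa [Complex.conj_conj, map_one] at this
  set m : ι → ℝ := fun i => (∑ k ∈ Finset.range T, ‖A i k‖ ^ 2) / T with hm
  have hTR : (0 : ℝ) < T := by exact_mod_cast hT
  have hmpos : ∀ i, 0 < m i := fun i => by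
    have : 0 < ∑ k ∈ Finset.range T, ‖A i k‖ ^ 2 :=
      (pow_pos (norm_pos_iff.2 (hA0 i)) 2).trans_le (Finset.single_le_sum
        (f := fun k => ‖A i k‖ ^ 2) (fun _ _ => by positivity) (Finset.mem_range.2 hT))
    positivity
  have hconj : ∀ i l, ∃ ν : ℂ, i ≠ l → (‖ν‖ < √(m i) * √(m l) ∧ (ξ i ^ 2 ≠ ξ l ^ 2 → ν = 0) ∧
      AveragesTo (fun n => 1 * ‖A i n‖ + -1 * ‖starRingEnd ℂ (A l n)‖)
        (fun n => A i n * starRingEnd ℂ (A l n)) ν) := by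
    intro i l
    by_cases hil : i = l
    · exact ⟨0, fun h => absurd hil h⟩
    · obtain ⟨ν, hν⟩ := exists_averagesTo_mul_conj hT (hA i) (hA l) (hx i) (hx l) (hA0 i) (hA0 l)
        (hpar i l hil)
      exact ⟨ν, fun _ => hν⟩
  choose ν hν using hconj
  obtain ⟨c, hc, hcl⟩ := exists_weights I (r := fun i => √(m i)) (ρ := fun i l => ‖ν i l‖)
    (fun i => Real.sqrt_pos.2 (hmpos i)) (fun i l h => (hν i l h).1)
    (fun i j l hi hj hi0 hj0 => huniq i j l hi hj
      (by by_contra h; exact hi0 (by simp [(hν i l hi).2.1 h]))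
      (by by_contra h; exact hj0 (by simp [(hν j l hj).2.1 h])))
  set C := ∑ i ∈ I, c i with hC
  have hC0 : 0 ≤ C := Finset.sum_nonneg fun i _ => (hc i).le
  set F₀ := C * a with hF₀
  have hF₀0 : 0 ≤ F₀ := by positivity
  have hFb : ∀ n (z : ι → ℂ), |∑ i ∈ I, c i * (sqPhase (z i) * ψ i n ^ 2).im| ≤ F₀ := by
    intro n z
    refine (Finset.abs_sum_le_sum_abs _ _).trans ?_
    rw [hF₀, hC, Finset.sum_mul]
    refine Finset.sum_le_sum fun i hi => ?_
    rw [abs_mul, abs_of_pos (hc i)]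
    refine mul_le_mul_of_nonneg_left ((Complex.abs_im_le_norm _).trans ?_) (hc i).le
    rw [norm_mul]
    exact (mul_le_of_le_one_left (norm_nonneg _) (norm_sqPhase_le _)).trans (ha i hi n)
  -- C + 2 counts the errors: C from the weighted products, one from the drift term and one from the
  -- quadratic terms.
  set ε := min δ (1 / 2) / (C + 2) with hε_def
  have hε : 0 < ε := div_pos (lt_min hδ (by norm_num)) (by positivity)
  have hε1 : (C + 2) * ε ≤ δ := by
    rw [hε_def, mul_div_cancel₀ _ (by positivity)]; exact min_le_left _ _
  have hε2 : (C + 2) * ε ≤ 1 / 2 := by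
    rw [hε_def, mul_div_cancel₀ _ (by positivity)]; exact min_le_right _ _
  have ev1 : ∀ᶠ κ : ℝ in atTop, ∀ᶠ N : ℕ in atTop, ∀ i ∈ I, ∀ l ∈ I,
      PhaseSumBound (A i) (A l) (fun n => A i n * A l n) 1 1 a F₀ ε 0 κ N := by
    simp only [eventually_all_finset]
    intro i hi l hl
    simpa using eventually_phaseSumBound (hav i) (hav l)
      (averagesTo_mul hT (hA i) (hA l) (hx i) (hx l) (hA0 i)) (zero_le_one.trans ha1) hF₀0 hε
  have ev2 : ∀ᶠ κ : ℝ in atTop, ∀ᶠ N : ℕ in atTop, ∀ i ∈ I, ∀ l ∈ I, i ≠ l →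
      PhaseSumBound (A i) (fun n => starRingEnd ℂ (A l n)) (fun n => A i n * starRingEnd ℂ (A l n))
        1 (-1) a F₀ ε ‖ν i l‖ κ N := by
    simp only [eventually_all_finset]
    intro i hi l hl
    by_cases hil : i = l
    · simp [hil]
    · simpa [hil] using eventually_phaseSumBound (hav i) (havc l) (hν i l hil).2.2
        (zero_le_one.trans ha1) hF₀0 hε
  -- The weights, hence F₀, do not depend on κ, so κ can be taken large afterwards.
  obtain ⟨κ, hκ1, hκ2, hκ⟩ := (ev1.and (ev2.and (eventually_gt_atTop 0))).exists
  set D := κ + F₀ with hD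
  have hD0 : 0 < D := by positivity
  have hcontrol : ∀ n z, |feedbackPotential I c κ ψ n z| ≤ D / n := by
    intro n z
    rw [feedbackPotential, abs_div, Nat.abs_cast]
    gcongr
    refine (abs_add_le _ _).trans ?_
    rw [abs_of_pos hκ]
    linarith [hFb n z]
  have ev3 : ∀ᶠ N : ℕ in atTop, ∀ l ∈ I, ∀ M, N ≤ M → ∀ P, SlowlyVarying (4 * (D * a)) N M P →
      ‖∑ n ∈ Finset.Ico N M, (1 / n : ℂ) * (P n * A l n)‖ ≤ ε / κ := by
    rw [eventually_all_finset]
    intro l hl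
    obtain ⟨H, μ, hH, h⟩ := hav l
    simp only [Pi.zero_apply, Complex.ofReal_zero, mul_zero, add_zero] at h
    filter_upwards [eventually_norm_sum_le (D := 4 * (D * a)) hH (by positivity)
      (show 0 < ε / κ by positivity)] with N hN M hM P hP
    simp only [h]
    exact hN M hM P hP
  have ev4 : ∀ᶠ N : ℕ in atTop, ∀ l ∈ I, ∀ M, N ≤ M →
      m l * ∑ n ∈ Finset.Ico N M, (1 / n : ℝ) - ε
        ≤ ∑ n ∈ Finset.Ico N M, (1 / n : ℝ) * ‖A l n‖ ^ 2 := by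
    rw [eventually_all_finset]
    intro l hl
    obtain ⟨H, hH, h⟩ := exists_primitive_of_periodic hT (g := fun n => ((‖A l n‖ ^ 2 : ℝ) : ℂ))
      (fun n => by rw [hA, norm_mul, hx, one_mul])
    filter_upwards [eventually_norm_sum_le (D := 0) hH le_rfl hε] with N hN M hM
    have h1 := hN M hM _ (SlowlyVarying.one N M)
    have h2 : ∑ n ∈ Finset.Ico N M, (1 / n : ℂ) * (1 * (H (n + 1) - H n))
        = ((∑ n ∈ Finset.Ico N M, (1 / n : ℝ) * ‖A l n‖ ^ 2
          - m l * ∑ n ∈ Finset.Ico N M, (1 / n : ℝ) : ℝ) : ℂ) := by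
      rw [Finset.mul_sum, ← Finset.sum_sub_distrib, Complex.ofReal_sum]
      refine Finset.sum_congr rfl fun n _ => ?_
      have h3 := h n
      simp only [hm]
      push_cast at h3 ⊢
      linear_combination -(1 / n : ℂ) * h3
    rw [h2, Complex.norm_real, Real.norm_eq_abs] at h1
    linarith [(abs_le.1 h1).1]
  have hlim : ∀ x : ℝ, Tendsto (fun N : ℕ => x / N) atTop (𝓝 0) :=
    tendsto_const_div_atTop_nhds_zero_nat
  obtain ⟨N₀, hN₀⟩ := eventually_atTop.1 (hκ1.and (hκ2.and (ev3.and (ev4.and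
    (((hlim (D * a)).eventually (ge_mem_nhds (one_half_pos (α := ℝ)))).and
      (((hlim (2 * (D * a) ^ 2)).eventually (ge_mem_nhds hε)).and (eventually_ge_atTop 1)))))))
  refine ⟨c, κ, D, N₀, hcontrol, fun N hN M hM Z hZ l hl => ?_⟩
  obtain ⟨b1, b2, b3, b4, b5, b6, hN1⟩ := hN₀ N hN
  set q : ℕ → ℝ := fun n => feedbackPotential I c κ ψ n fun j => Z j n with hq
  set F : ℕ → ℝ := fun n => ∑ i ∈ I, c i * (sqPhase (Z i n) * A i n).im with hF
  set p : ι → ℕ → ℂ := fun i n => sqPhase (Z i n) with hp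
  set S := ∑ n ∈ Finset.Ico N M, (1 / n : ℝ) with hS
  have hqF : ∀ n, N ≤ n → n < M → q n = (κ + F n) / n := fun n _ _ => rfl
  have hFF : ∀ n, |F n| ≤ F₀ := fun n => hFb n fun j => Z j n
  have hqa : ∀ n, N ≤ n → n < M → |q n| * a ≤ 1 / 2 := fun n h1 _ => by
    have hNR : (0 : ℝ) < N := by exact_mod_cast hN1
    refine le_trans ?_ b5
    calc |q n| * a ≤ D / n * a := by gcongr; exact hcontrol _ _
      _ ≤ D / N * a := by gcongr
      _ = D * a / N := by ring
  have hphase : ∀ i ∈ I, PhaseEquation q a 1 (A i) N M (p i) := fun i hi =>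
    phaseEquation_of_kick (hZ.ne_zero i hi) (hZ.step i hi) (ha i hi) hqa
  refine (norm_sq_le_of_kick hM (hZ.step l hl)).trans ?_
  refine mul_le_mul_of_nonneg_left (Real.exp_le_exp.2 ?_) (sq_nonneg _)
  have hquad : ∑ n ∈ Finset.Ico N M, (q n * ‖ψ l n ^ 2‖) ^ 2 ≤ ε := by
    have h1 : ∀ n ∈ Finset.Ico N M, (q n * ‖ψ l n ^ 2‖) ^ 2 ≤ (D * a) ^ 2 * (1 / (n : ℝ) ^ 2) := by
      intro n _
      rw [← sq_abs, abs_mul, abs_norm]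
      calc (|q n| * ‖ψ l n ^ 2‖) ^ 2 ≤ (D / n * a) ^ 2 := by
            gcongr
            · exact hcontrol _ _
            · exact ha l hl n
        _ = _ := by ring
    refine (Finset.sum_le_sum h1).trans ?_
    rw [← Finset.mul_sum]
    refine (mul_le_mul_of_nonneg_left (sum_Ico_one_div_sq_le hN1 hM) (sq_nonneg _)).trans ?_
    refine le_trans (le_of_eq ?_) b6
    ring
  have hdrift : -ε ≤ κ * ∑ n ∈ Finset.Ico N M, (1 / n : ℝ) * (p l n * A l n).im := by
    have h1 := b3 l hl M hM _ ((hphase l hl).slowlyVarying fun n _ _ => hcontrol n _)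
    have h2 : ∑ n ∈ Finset.Ico N M, (1 / n : ℝ) * (p l n * A l n).im
        = (∑ n ∈ Finset.Ico N M, (1 / n : ℂ) * (p l n * A l n)).im := by
      rw [Complex.im_sum]
      refine Finset.sum_congr rfl fun n _ => ?_
      rw [← Complex.im_ofReal_mul]
      push_cast; rfl
    rw [h2]
    have h3 := (abs_le.1 ((Complex.abs_im_le_norm _).trans h1)).1
    have h4 := mul_le_mul_of_nonneg_left h3 hκ.le
    have h5 : κ * -(ε / κ) = -ε := by field_simp
    linarith
  set X : ι → ℝ := fun i =>
    ∑ n ∈ Finset.Ico N M, (1 / n : ℝ) * ((p i n * A i n).im * (p l n * A l n).im) with hX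
  have hre : ∀ g : ℕ → ℂ, ∑ n ∈ Finset.Ico N M, (1 / n : ℝ) * (g n).re
      = (∑ n ∈ Finset.Ico N M, (1 / n : ℂ) * g n).re := fun g => by
    rw [Complex.re_sum]
    refine Finset.sum_congr rfl fun n _ => ?_
    rw [← Complex.re_ofReal_mul]
    push_cast; rfl
  have hXe : ∀ i, X i = (∑ n ∈ Finset.Ico N M, (1 / n : ℝ) *
        (p i n * A i n * starRingEnd ℂ (p l n * A l n)).re) / 2
      - (∑ n ∈ Finset.Ico N M, (1 / n : ℂ) * (p i n * p l n * (A i n * A l n))).re / 2 := by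
    intro i
    rw [← hre, Finset.sum_div, Finset.sum_div, ← Finset.sum_sub_distrib, hX]
    refine Finset.sum_congr rfl fun n _ => ?_
    rw [im_mul_im, mul_mul_mul_comm (p i n) (A i n) (p l n) (A l n)]
    ring
  have hXplus : ∀ i ∈ I,
      (∑ n ∈ Finset.Ico N M, (1 / n : ℂ) * (p i n * p l n * (A i n * A l n))).re ≤ ε * S + ε := by
    intro i hi
    have h1 := b1 i hi l hl M hM q F (p i) (p l) (hphase i hi) (hphase l hl) hqF hFF
    rw [zero_add] at h1
    exact (Complex.re_le_norm _).trans h1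
  have hXl : m l * S / 2 - (ε * S + 2 * ε) / 2 ≤ X l := by
    have h1 : ∑ n ∈ Finset.Ico N M, (1 / n : ℝ) *
        (p l n * A l n * starRingEnd ℂ (p l n * A l n)).re
        = ∑ n ∈ Finset.Ico N M, (1 / n : ℝ) * ‖A l n‖ ^ 2 := by
      refine Finset.sum_congr rfl fun n hn => ?_
      rw [Finset.mem_Ico] at hn
      have hz := ne_zero_of_kick (hZ.ne_zero l hl) (hZ.step l hl) n hn.1 hn.2.le
      rw [Complex.mul_conj, Complex.ofReal_re, Complex.normSq_eq_norm_sq, norm_mul, hp]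
      simp only [sqPhase, norm_div, RCLike.norm_conj]
      rw [div_self (norm_ne_zero_iff.2 hz), one_mul]
    rw [hXe l, h1]
    have h2 := b4 l hl M hM
    have h3 := hXplus l hl
    linarith
  have hXi : ∀ i ∈ I.erase l, -(‖ν i l‖ * S) / 2 - (ε * S + ε) ≤ X i := by
    intro i hi
    rw [Finset.mem_erase] at hi
    have h1 := b2 i hi.2 l hl hi.1 M hM q F (p i) (fun n => starRingEnd ℂ (p l n)) (hphase i hi.2)
      (hphase l hl).star hqF hFF
    have h2 : ∑ n ∈ Finset.Ico N M, (1 / n : ℝ) *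
          (p i n * A i n * starRingEnd ℂ (p l n * A l n)).re
        = (∑ n ∈ Finset.Ico N M, (1 / n : ℂ) *
          (p i n * starRingEnd ℂ (p l n) * (A i n * starRingEnd ℂ (A l n)))).re := by
      rw [← hre]
      refine Finset.sum_congr rfl fun n _ => ?_
      rw [map_mul, mul_mul_mul_comm]
    rw [hXe i, h2]
    have h3 := (abs_le.1 ((Complex.abs_re_le_norm _).trans h1)).1
    have h4 := hXplus i hi.2
    linarith
  have htotal : ∑ n ∈ Finset.Ico N M, q n * (sqPhase (Z l n) * ψ l n ^ 2).im
      = κ * (∑ n ∈ Finset.Ico N M, (1 / n : ℝ) * (p l n * A l n).im) + ∑ i ∈ I, c i * X i := by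
    rw [hX]
    simp only [Finset.mul_sum]
    rw [Finset.sum_comm, ← Finset.sum_add_distrib]
    refine Finset.sum_congr rfl fun n hn => ?_
    rw [Finset.mem_Ico] at hn
    rw [hqF n hn.1 hn.2, hF]
    simp only [hp, add_div, add_mul, Finset.sum_div, Finset.sum_mul]
    congr 1
    · ring
    · exact Finset.sum_congr rfl fun i _ => by ring
  rw [Finset.sum_add_distrib, Finset.sum_neg_distrib, htotal]
  have hS0 : 0 ≤ S := Finset.sum_nonneg fun _ _ => by positivity
  clear_value S
  -- The gap 4 of the weights is halved by the product formula for imaginary parts; the decay 2 S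
  -- leaves S / 2 to absorb errors.
  have hfeed : 2 * S - C * (ε * S + ε) ≤ ∑ i ∈ I, c i * X i := by
    rw [← Finset.add_sum_erase I (fun i => c i * X i) hl]
    have h1 := mul_le_mul_of_nonneg_left hXl (hc l).le
    have h2 := Finset.sum_le_sum fun i hi =>
      mul_le_mul_of_nonneg_left (hXi i hi) (hc i).le
    have h3 : ∑ i ∈ I.erase l, c i * (-(‖ν i l‖ * S) / 2 - (ε * S + ε))
        = -(S / 2) * (∑ i ∈ I.erase l, c i * ‖ν i l‖)
          - (∑ i ∈ I.erase l, c i) * (ε * S + ε) := by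
      rw [Finset.mul_sum, Finset.sum_mul, ← Finset.sum_sub_distrib]
      exact Finset.sum_congr rfl fun i _ => by ring
    have h4 : C = c l + ∑ i ∈ I.erase l, c i := by
      rw [hC, Finset.add_sum_erase I c hl]
    have h5 := mul_le_mul_of_nonneg_left (hcl l hl) hS0
    rw [Real.sq_sqrt (hmpos l).le] at h5
    have h6 : 0 ≤ c l * (ε * S) := by have := hc l; positivity
    rw [h4]
    linarith
  have h7 : (C + 2) * ε * S ≤ 1 / 2 * S := mul_le_mul_of_nonneg_right hε2 hS0
  have h8 : 0 ≤ ε * S := by positivity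
  linarith

/-! ### Countably many solutions: gluing the stages -/

/-- The harmonic sum dominates log n, so the bound is at most C n^(-3/2). -/
theorem summable_of_le_exp_neg_harmonic {x : ℕ → ℝ} {C : ℝ} {n₀ : ℕ} (hx : ∀ n, 0 ≤ x n)
    (h : ∀ n, n₀ ≤ n →
      x n ≤ C * Real.exp (-(3 / 2) * ∑ m ∈ Finset.Ico 1 n, (1 / m : ℝ))) : Summable x := by
  have hC : 0 ≤ C := by
    have h1 := (hx n₀).trans (h n₀ le_rfl)
    exact nonneg_of_mul_nonneg_left h1 (Real.exp_pos _)
  have hs : Summable fun n : ℕ => C * (n : ℝ) ^ (-(3 / 2) : ℝ) :=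
    (Real.summable_nat_rpow.2 (by norm_num)).mul_left C
  refine Summable.of_norm_bounded_eventually_nat hs ?_
  filter_upwards [eventually_ge_atTop n₀, eventually_ge_atTop 1] with n hn hn1
  rw [Real.norm_of_nonneg (hx n)]
  refine (h n hn).trans (mul_le_mul_of_nonneg_left ?_ hC)
  have hnR : (0 : ℝ) < n := by exact_mod_cast hn1
  rw [Real.rpow_def_of_pos hnR]
  refine Real.exp_le_exp.2 ?_
  have hlog : Real.log n ≤ ∑ m ∈ Finset.Ico 1 n, (1 / m : ℝ) := by
    obtain ⟨k, rfl⟩ := Nat.exists_eq_add_of_le' hn1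
    have := log_add_one_le_harmonic k
    rw [Finset.sum_Ico_eq_sum_range]
    simp only [harmonic, Rat.cast_sum, Rat.cast_inv, Rat.cast_natCast] at this
    simp only [Nat.add_sub_cancel, one_div, add_comm 1]
    exact_mod_cast this
  linarith

/-- For a countable family of Floquet solutions, of which at most two at a time are in resonance, a
potential of size `K n / n` makes all coefficients square summable. -/
theorem exists_potential {ι : Type*} [Countable ι] {T : ℕ} (hT : 0 < T)
    {ψ : ι → ℕ → ℂ} {ξ : ι → ℂ} (hψ : ∀ i n, ψ i (n + T) = ξ i * ψ i n) (hψ0 : ∀ i, ψ i 0 ≠ 0)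
    (hξ : ∀ i, ‖ξ i‖ = 1) (hξ2 : ∀ i, ξ i ^ 2 ≠ 1)
    (huniq : ∀ i j l, i ≠ l → j ≠ l → ξ i ^ 2 = ξ l ^ 2 → ξ j ^ 2 = ξ l ^ 2 → i = j)
    (hpar : ∀ i l, i ≠ l → ∀ z : ℂ, ‖z‖ = 1 → ∃ n, ψ i n ^ 2 ≠ z * ψ l n ^ 2)
    {K : ℕ → ℝ} (hKpos : ∀ n, 1 ≤ n → 0 < K n) (hK : Tendsto K atTop atTop)
    {z₀ : ι → ℂ} (hz₀ : ∀ i, z₀ i ≠ 0) :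
    ∃ q : ℕ → ℝ, (∀ n, 1 ≤ n → |q n| ≤ K n / n) ∧ Tendsto q atTop (𝓝 0) ∧
      ∃ Z : ι → ℕ → ℂ, ∀ i, Z i 1 = z₀ i ∧
        (∀ n, Z i (n + 1) = kick (q n) (ψ i n) (Z i n)) ∧ Summable fun n => ‖Z i n‖ ^ 2 := by
  classical
  obtain ⟨f, hf⟩ := exists_injective_nat ι
  set I : ℕ → Finset ι := fun s => (Finset.range (s + 1)).preimage f hf.injOn with hI
  have hmem : ∀ i s, f i ≤ s → i ∈ I s := fun i s h => by
    simp only [hI, Finset.mem_preimage, Finset.mem_range]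
    omega
  choose c κ D N₀ hD hgrow using fun s : ℕ =>
    exists_feedbackPotential (I s) hT hψ hψ0 hξ hξ2 huniq hpar (δ := (1 / 2) ^ s) (by positivity)
  have hsqrt : Tendsto (fun n : ℕ => √(n : ℝ)) atTop atTop :=
    Real.tendsto_sqrt_atTop.comp tendsto_natCast_atTop_atTop
  -- Stage s starts at N s. The bound by K n gives the required size of the potential, the one by √n
  -- its convergence to 0.
  obtain ⟨N, hNmono, hN⟩ := extraction_forall_of_eventually
    (P := fun s k => N₀ s ≤ k ∧ 1 ≤ k ∧ ∀ n, k ≤ n → D s ≤ K n ∧ D s ≤ √(n : ℝ)) (fun s =>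
      (eventually_ge_atTop (N₀ s)).and ((eventually_ge_atTop 1).and
        (eventually_forall_ge_atTop.2
          ((hK.eventually_ge_atTop (D s)).and (hsqrt.eventually_ge_atTop (D s))))))
  set stage : ℕ → ℕ := fun n => Nat.findGreatest (fun s => N s ≤ n) n with hstage
  have hstage_le : ∀ n, N 0 ≤ n → N (stage n) ≤ n := fun n hn =>
    Nat.findGreatest_spec (P := fun s => N s ≤ n) (Nat.zero_le n) hn
  have hstage_eq : ∀ s n, N s ≤ n → n < N (s + 1) → stage n = s := by
    intro s n h1 h2
    rw [hstage]
    refine Nat.findGreatest_eq_iff.2 ⟨(hNmono.id_le s).trans h1, fun _ => h1, fun k hk _ h3 => ?_⟩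
    exact absurd (hNmono.monotone (show s + 1 ≤ k from hk)) (by omega)
  set rule : ℕ → (ι → ℂ) → ℝ := fun n w =>
    if n < N 0 then 0 else feedbackPotential (I (stage n)) (c (stage n)) (κ (stage n)) ψ n w
    with hrule
  -- All coefficients are constructed simultaneously, since the potential at n depends on their
  -- current values.
  set W : ℕ → ι → ℂ := fun n =>
    Nat.rec z₀ (fun k w i => kick (rule k w) (ψ i k) (w i)) n with hW
  have hstep : ∀ i n, W (n + 1) i = kick (rule n (W n)) (ψ i n) (W n i) := fun _ _ => rfl
  have hne : ∀ i n, W n i ≠ 0 := by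
    intro i n
    induction n with
    | zero => exact hz₀ i
    | succ n ih => rw [hstep]; exact kick_ne_zero ih
  have hbound : ∀ n, N 0 ≤ n → |rule n (W n)| ≤ D (stage n) / n := fun n hn => by
    simp only [hrule, if_neg (not_lt.2 hn)]
    exact hD _ _ _
  refine ⟨fun n => rule n (W n), fun n hn => ?_, ?_, fun i n => W n i, fun i => ⟨?_, hstep i, ?_⟩⟩
  · rcases lt_or_ge n (N 0) with h | h
    · simp only [hrule, if_pos h, abs_zero]
      have := hKpos n hn
      positivity
    · refine (hbound n h).trans ?_
      gcongr
      exact ((hN _).2.2 n (hstage_le n h)).1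
  · rw [tendsto_zero_iff_abs_tendsto_zero]
    have hlim : Tendsto (fun n : ℕ => (√(n : ℝ))⁻¹) atTop (𝓝 0) := tendsto_inv_atTop_zero.comp hsqrt
    refine squeeze_zero' (Eventually.of_forall fun n => abs_nonneg _) ?_ hlim
    filter_upwards [eventually_ge_atTop (N 0)] with n hn
    refine (hbound n hn).trans ?_
    have h1 := ((hN _).2.2 n (hstage_le n hn)).2
    calc D (stage n) / n ≤ √(n : ℝ) / n := by gcongr
      _ = _ := Real.sqrt_div_self
  -- The potential vanishes before N 0 ≥ 1, so the step from index 0 to 1 leaves z₀ unchanged.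
  · have h0 : 0 < N 0 := (hN 0).2.1
    refine (hstep i 0).trans ?_
    simp only [hrule, if_pos h0]
    simp [kick, hW]
  · set H : ℕ → ℝ := fun n => ∑ m ∈ Finset.Ico 1 n, (1 / m : ℝ) with hH
    -- Φ compensates the expected decay. In stage s it grows by at most exp((1/2)^s), so it stays
    -- bounded once i has entered the family.
    set Φ : ℕ → ℝ := fun n => ‖W n i‖ ^ 2 * Real.exp (3 / 2 * H n) with hΦ
    have hΦ0 : ∀ n, 0 ≤ Φ n := fun n => by positivity
    have hcontrolled : ∀ s M, M ≤ N (s + 1) →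
        IsControlled (I s) (c s) (κ s) ψ (N s) M fun i n => W n i := by
      refine fun s M hM => ⟨fun i _ => hne i _, fun i _ n h1 h2 => ?_⟩
      rw [hstep]
      have h3 : N 0 ≤ n := (hNmono.monotone (Nat.zero_le s)).trans h1
      simp only [hrule, if_neg (not_lt.2 h3), hstage_eq s n h1 (by omega)]
    have hstageΦ : ∀ s, f i ≤ s → ∀ n, N s ≤ n → n ≤ N (s + 1) →
        Φ n ≤ Φ (N s) * Real.exp ((1 / 2) ^ s) := by
      intro s hs n h1 h2
      have h3 := hgrow s (N s) (hN s).1 n h1 _ (hcontrolled s n h2) i (hmem i s hs)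
      have h4 : H n = H (N s) + ∑ m ∈ Finset.Ico (N s) n, (1 / m : ℝ) :=
        (Finset.sum_Ico_consecutive _ (hN s).2.1 h1).symm
      simp only [hΦ]
      refine (mul_le_mul_of_nonneg_right h3 (Real.exp_pos _).le).trans (le_of_eq ?_)
      rw [mul_assoc, mul_assoc, ← Real.exp_add, ← Real.exp_add, h4]
      ring_nf
    have hchain : ∀ s, f i ≤ s →
        Φ (N s) ≤ Φ (N (f i)) * Real.exp (2 - 2 * (1 / 2) ^ s) := by
      intro s hs
      induction s, hs using Nat.le_induction with
      | base =>
        refine le_mul_of_one_le_right (hΦ0 _) (Real.one_le_exp ?_)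
        have : ((1 : ℝ) / 2) ^ (f i) ≤ 1 := pow_le_one₀ (by norm_num) (by norm_num)
        linarith
      | succ s hs ih =>
        refine (hstageΦ s hs _ (hNmono.monotone (Nat.le_succ s)) le_rfl).trans ?_
        refine (mul_le_mul_of_nonneg_right ih (Real.exp_pos _).le).trans (le_of_eq ?_)
        rw [mul_assoc, ← Real.exp_add, pow_succ]
        ring_nf
    refine summable_of_le_exp_neg_harmonic (C := Φ (N (f i)) * Real.exp 2) (n₀ := N (f i))
      (fun n => by positivity) fun n hn => ?_
    have hn0 : N 0 ≤ n := (hNmono.monotone (Nat.zero_le _)).trans hn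
    have hlt : n < N (stage n + 1) := by
      by_contra hcon
      have h1 := Nat.le_findGreatest (P := fun s => N s ≤ n) ((hNmono.id_le _).trans (not_lt.1 hcon))
        (not_lt.1 hcon)
      exact Nat.not_succ_le_self _ h1
    have hsi : f i ≤ stage n := by
      by_contra hcon
      exact absurd (hNmono.monotone (show stage n + 1 ≤ f i by omega)) (by omega)
    have h1 := (hstageΦ _ hsi n (hstage_le n hn0) hlt.le).trans
      (mul_le_mul_of_nonneg_right (hchain _ hsi) (Real.exp_pos _).le)
    have h2 : Φ n ≤ Φ (N (f i)) * Real.exp 2 := by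
      refine h1.trans ?_
      rw [mul_assoc, ← Real.exp_add]
      refine mul_le_mul_of_nonneg_left (Real.exp_le_exp.2 ?_) (hΦ0 _)
      have : (0 : ℝ) ≤ (1 / 2) ^ stage n := by positivity
      linarith
    have h3 := mul_le_mul_of_nonneg_right h2 (Real.exp_pos (-(3 / 2) * H n)).le
    refine le_trans (le_of_eq ?_) h3
    simp only [hΦ]
    rw [mul_assoc, ← Real.exp_add]
    ring_nf
    simp

/-! ### Floquet solutions of the periodic operator -/

namespace PeriodicJacobi

variable {T : ℕ+} (J : PeriodicJacobi T)

/-- A complex Floquet solution `ψ` with multiplier `ξ`, normalized by its Wronskian with its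
conjugate. -/
structure IsFloquet (lam : ℝ) (ξ : ℂ) (ψ : ℕ → ℂ) : Prop where
  norm_multiplier : ‖ξ‖ = 1
  two_mul_re : 2 * ξ.re = (J.monodromy lam).trace
  quasi_periodic : ∀ n, ψ (n + T) = ξ * ψ n
  recurrence : ∀ n, (J.a n : ℂ) * ψ n + J.b (n + 1) * ψ (n + 1) + J.a (n + 1) * ψ (n + 2)
    = lam * ψ (n + 1)
  wronskian : ∀ n, J.a n * (starRingEnd ℂ (ψ n) * ψ (n + 1)).im = 1

theorem transfer_add (lam : ℝ) (k : ℕ) : J.transfer lam (k + T) = J.transfer lam k := by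
  have h1 : k + (T : ℕ) + 1 = k + 1 + T := by omega
  rw [transfer, transfer, h1, J.a_periodic, J.a_periodic, J.b_periodic]

theorem transferProd_add (lam : ℝ) (n : ℕ) :
    J.transferProd lam (n + T) = J.transferProd lam n * J.monodromy lam := by
  induction n with
  | zero => simp [transferProd, monodromy]
  | succ n ih =>
    rw [show n + 1 + (T : ℕ) = n + T + 1 by omega, transferProd, ih, transfer_add, transferProd,
      Matrix.mul_assoc]

/-- An eigenvector of the monodromy matrix is propagated by the transfer matrices. Of the two
conjugate eigenvalues, the one making the Wronskian positive is taken, and r normalizes it to 1. -/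
theorem exists_isFloquet {lam : ℝ} (h : lam ∈ J.sigmaEll) : ∃ ξ ψ, J.IsFloquet lam ξ ψ := by
  set P := J.transferProd lam with hP
  set M := J.monodromy lam with hM
  have htr : M.trace = M 0 0 + M 1 1 := Matrix.trace_fin_two _
  have hdet : M 0 0 * M 1 1 - M 0 1 * M 1 0 = 1 := by
    rw [← Matrix.det_fin_two, hM, J.det_monodromy]
  have hlt : |M.trace| < 2 := h
  have hsq : M.trace ^ 2 < 4 := by
    rw [← sq_abs]
    nlinarith [abs_nonneg M.trace]
  -- A triangular real matrix of determinant 1 has squared trace at least 4.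
  have hβ : M 0 1 ≠ 0 := by
    intro h0
    rw [h0] at hdet
    rw [htr] at hsq
    nlinarith [sq_nonneg (M 0 0 - M 1 1)]
  set σ := √(1 - M.trace ^ 2 / 4) with hσ
  have hσpos : 0 < σ := Real.sqrt_pos.2 (by linarith)
  have hσsq : σ ^ 2 = 1 - M.trace ^ 2 / 4 := Real.sq_sqrt (by linarith)
  obtain ⟨s, hs, hsβ⟩ : ∃ s : ℝ, s ^ 2 = 1 - M.trace ^ 2 / 4 ∧ 0 < M 0 1 * s := by
    rcases lt_or_gt_of_ne hβ with h1 | h1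
    · exact ⟨-σ, by rw [neg_sq, hσsq], by nlinarith⟩
    · exact ⟨σ, hσsq, by positivity⟩
  set ξ : ℂ := ⟨M.trace / 2, s⟩ with hξ
  have hquad : ξ ^ 2 = M.trace * ξ - 1 := by
    apply Complex.ext
    · simp [sq, hξ]; linarith
    · simp [sq, hξ]; ring
  have ha0 := J.a_pos 0
  set r := 1 / √(J.a 0 * (M 0 1 * s)) with hr
  have hrr : r ^ 2 * (J.a 0 * (M 0 1 * s)) = 1 := by
    rw [hr, div_pow, Real.sq_sqrt (by positivity), one_pow]
    exact one_div_mul_cancel (by positivity)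
  set v₀ : ℂ := r * M 0 1 with hv₀
  set v₁ : ℂ := r * (ξ - M 0 0) with hv₁
  have hev0 : (M 0 0 : ℂ) * v₀ + M 0 1 * v₁ = ξ * v₀ := by
    rw [hv₀, hv₁]; ring
  have hev1 : (M 1 0 : ℂ) * v₀ + M 1 1 * v₁ = ξ * v₁ := by
    have hd : ((M 0 0 : ℝ) : ℂ) * M 1 1 - M 0 1 * M 1 0 = 1 := by exact_mod_cast hdet
    rw [htr] at hquad
    push_cast at hquad
    rw [hv₀, hv₁]
    linear_combination (-(r : ℂ)) * hquad - (r : ℂ) * hd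
  have hsucc0 : ∀ n j, P (n + 1) 0 j = P n 1 j := fun n j => by
    simp [hP, transferProd, transfer, Matrix.mul_apply, Fin.sum_univ_two]
  have hsucc1 : ∀ n j, J.a n * P n 0 j + J.b (n + 1) * P n 1 j + J.a (n + 1) * P (n + 1) 1 j
      = lam * P n 1 j := fun n j => by
    have := (J.a_pos (n + 1)).ne'
    simp only [hP, transferProd, transfer, Matrix.mul_apply, Fin.sum_univ_two, Matrix.of_apply,
      Matrix.cons_val', Matrix.cons_val_zero, Matrix.cons_val_one, Matrix.cons_val_fin_one]
    field_simp
    ring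
  set ψ : ℕ → ℂ := fun n => P n 0 0 * v₀ + P n 0 1 * v₁ with hψ
  have hψ1 : ∀ n, ψ (n + 1) = P n 1 0 * v₀ + P n 1 1 * v₁ := fun n => by
    simp only [hψ, hsucc0]
  have hrec : ∀ n, (J.a n : ℂ) * ψ n + J.b (n + 1) * ψ (n + 1) + J.a (n + 1) * ψ (n + 2)
      = lam * ψ (n + 1) := fun n => by
    have h0 : ((J.a n * P n 0 0 + J.b (n + 1) * P n 1 0 + J.a (n + 1) * P (n + 1) 1 0 : ℝ) : ℂ)
      = ((lam * P n 1 0 : ℝ) : ℂ) := congrArg _ (hsucc1 n 0)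
    have h1 : ((J.a n * P n 0 1 + J.b (n + 1) * P n 1 1 + J.a (n + 1) * P (n + 1) 1 1 : ℝ) : ℂ)
      = ((lam * P n 1 1 : ℝ) : ℂ) := congrArg _ (hsucc1 n 1)
    push_cast at h0 h1
    rw [hψ1 (n + 1), hψ1 n]
    simp only [hψ]
    linear_combination v₀ * h0 + v₁ * h1
  refine ⟨ξ, ψ, ⟨?_, ?_, fun n => ?_, hrec, fun n => ?_⟩⟩
  · rw [← sq_eq_sq₀ (norm_nonneg _) zero_le_one, ← Complex.normSq_eq_norm_sq, Complex.normSq_apply]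
    simp only [hξ]
    linarith
  · simp only [hξ]; ring
  · simp only [hψ, hP, transferProd_add, Matrix.mul_apply, Fin.sum_univ_two]
    push_cast
    linear_combination (P n 0 0 : ℂ) * hev0 + (P n 0 1 : ℂ) * hev1
  · induction n with
    | zero =>
      have h0 : ψ 0 = v₀ := by simp [hψ, hP, transferProd]
      have h1 : ψ (0 + 1) = v₁ := by rw [hψ1]; simp [hP, transferProd]
      rw [h0, h1, hv₀, hv₁]
      simp [Complex.mul_im, hξ]
      linarith
    | succ n ih =>
      -- Multiplied by conj ψ (n + 1), the real diagonal terms lose their imaginary part, leaving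
      -- conservation of the Wronskian.
      have h := congrArg (fun x => (starRingEnd ℂ (ψ (n + 1)) * x).im) (hrec n)
      simp only [Complex.mul_im, Complex.conj_re, Complex.conj_im, Complex.add_re, Complex.add_im,
        Complex.mul_re, Complex.ofReal_re, Complex.ofReal_im] at h ih ⊢
      linarith

namespace IsFloquet

variable {J} {lam lam' : ℝ} {ξ ξ' : ℂ} {ψ φ : ℕ → ℂ}

theorem ne_zero (h : J.IsFloquet lam ξ ψ) (n : ℕ) : ψ n ≠ 0 := by
  intro h0
  have := h.wronskian n
  simp [h0] at this

theorem multiplier_sq_re (h : J.IsFloquet lam ξ ψ) :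
    (ξ ^ 2).re = (J.monodromy lam).trace ^ 2 / 2 - 1 := by
  have h1 : ξ.re * ξ.re + ξ.im * ξ.im = 1 := by
    rw [← Complex.normSq_apply, Complex.normSq_eq_norm_sq, h.norm_multiplier, one_pow]
  rw [← h.two_mul_re, sq, Complex.mul_re]
  linarith

theorem multiplier_sq_ne_one (h : J.IsFloquet lam ξ ψ) (hl : lam ∈ J.sigmaEll) : ξ ^ 2 ≠ 1 := by
  intro h1
  have h2 := h.multiplier_sq_re
  rw [h1, Complex.one_re] at h2
  have hlt : |(J.monodromy lam).trace| < 2 := hl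
  have := sq_abs (J.monodromy lam).trace
  nlinarith [abs_nonneg (J.monodromy lam).trace]

/-- The spectral parameter is determined by the squares of the Floquet solution, up to a unimodular
constant. -/
theorem eq_of_sq_eq (h : J.IsFloquet lam ξ ψ) (h' : J.IsFloquet lam' ξ' φ) {z : ℂ} (hz : ‖z‖ = 1)
    (hs : ∀ n, ψ n ^ 2 = z * φ n ^ 2) : lam = lam' := by
  have hzz : z * starRingEnd ℂ z = 1 := by
    rw [Complex.mul_conj, Complex.normSq_eq_norm_sq, hz]; simp
  -- Equal squares determine these products up to sign, and the common Wronskian normalization fixes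
  -- the sign.
  have hprod : ∀ n, starRingEnd ℂ (ψ n) * ψ (n + 1) = starRingEnd ℂ (φ n) * φ (n + 1) := by
    intro n
    have h1 : (starRingEnd ℂ (ψ n) * ψ (n + 1)) ^ 2 = (starRingEnd ℂ (φ n) * φ (n + 1)) ^ 2 := by
      rw [mul_pow, ← map_pow, hs n, hs (n + 1), map_mul, map_pow]
      linear_combination starRingEnd ℂ (φ n) ^ 2 * φ (n + 1) ^ 2 * hzz
    rcases sq_eq_sq_iff_eq_or_eq_neg.1 h1 with h2 | h2
    · exact h2
    · have w := h.wronskian n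
      have w' := h'.wronskian n
      rw [h2, Complex.neg_im] at w
      linarith
  have hnorm : ψ 1 * starRingEnd ℂ (ψ 1) = φ 1 * starRingEnd ℂ (φ 1) := by
    have h1 := congrArg norm (hs 1)
    rw [norm_mul, hz, one_mul, norm_pow, norm_pow] at h1
    rw [Complex.mul_conj, Complex.mul_conj, Complex.normSq_eq_norm_sq, Complex.normSq_eq_norm_sq, h1]
  have r := h.recurrence 0
  have r' := h'.recurrence 0
  have p0 := congrArg (starRingEnd ℂ) (hprod 0)
  have p1 := hprod 1
  simp only [map_mul, Complex.conj_conj, zero_add, Nat.reduceAdd] at r r' p0 p1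
  -- The recurrence times conj ψ 1 expresses lam |ψ 1|² through the products just matched.
  have key : (lam : ℂ) * (φ 1 * starRingEnd ℂ (φ 1)) = lam' * (φ 1 * starRingEnd ℂ (φ 1)) := by
    linear_combination (-starRingEnd ℂ (ψ 1)) * r + starRingEnd ℂ (φ 1) * r'
      + (J.a 0 : ℂ) * p0 + (J.a 1 : ℂ) * p1 + ((J.b 1 : ℂ) - lam) * hnorm
  have hne : φ 1 * starRingEnd ℂ (φ 1) ≠ 0 :=
    mul_ne_zero (h'.ne_zero 1) (by simpa using h'.ne_zero 1)
  exact_mod_cast mul_right_cancel₀ hne key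

/-- The imaginary parts of `Z n * ψ n` solve the perturbed equation if `Z` evolves by kicks. -/
theorem im_recurrence (h : J.IsFloquet lam ξ ψ) {q : ℕ → ℝ} {Z : ℕ → ℂ}
    (hZ : ∀ n, Z (n + 1) = kick (q n) (ψ n) (Z n)) (n : ℕ) :
    J.a n * (Z (n + 1) * ψ n).im + (J.b (n + 1) + q (n + 1)) * (Z (n + 1) * ψ (n + 1)).im
      + J.a (n + 1) * (Z (n + 2) * ψ (n + 2)).im = lam * (Z (n + 1) * ψ (n + 1)).im := by
  have r := congrArg (fun x => (Z (n + 1) * x).im) (h.recurrence n)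
  have w := h.wronskian (n + 1)
  rw [show Z (n + 2) = _ from hZ (n + 1), kick]
  set t := (Z (n + 1) * ψ (n + 1)).im with ht
  have e : ((Z (n + 1) - ((q (n + 1) * t : ℝ) : ℂ) * starRingEnd ℂ (ψ (n + 1))) * ψ (n + 2)).im
      = (Z (n + 1) * ψ (n + 2)).im
        - q (n + 1) * t * (starRingEnd ℂ (ψ (n + 1)) * ψ (n + 1 + 1)).im := by
    rw [sub_mul, Complex.sub_im, mul_assoc, Complex.im_ofReal_mul]
  have r' : J.a n * (Z (n + 1) * ψ n).im + J.b (n + 1) * t + J.a (n + 1) * (Z (n + 1) * ψ (n + 2)).im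
      = lam * t := by
    rw [ht, ← Complex.im_ofReal_mul, ← Complex.im_ofReal_mul, ← Complex.im_ofReal_mul,
      ← Complex.im_ofReal_mul, ← Complex.add_im, ← Complex.add_im]
    refine Eq.trans ?_ (r.trans ?_)
    · congr 1; ring
    · congr 1; ring
  rw [e]
  -- The normalized Wronskian turns the kick into exactly the potential term q (n + 1) t.
  linear_combination r' - q (n + 1) * t * w

end IsFloquet

end PeriodicJacobi

/-! ### Resonances in terms of quasi-momenta -/

theorem Real.eq_or_add_eq_pi_of_cos_sq_eq {x y : ℝ} (hx : x ∈ Set.Icc 0 Real.pi)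
    (hy : y ∈ Set.Icc 0 Real.pi) (h : Real.cos x ^ 2 = Real.cos y ^ 2) :
    x = y ∨ x + y = Real.pi := by
  rcases sq_eq_sq_iff_eq_or_eq_neg.1 h with h1 | h1
  · exact Or.inl (Real.injOn_cos hx hy h1)
  · rw [← Real.cos_pi_sub] at h1
    have := Real.injOn_cos hx ⟨by linarith [hy.2], by linarith [hy.1]⟩ h1
    right; linarith

namespace PeriodicJacobi

variable {T : ℕ+} (J : PeriodicJacobi T)

theorem cos_quasiMomentum {lam : ℝ} (h : lam ∈ J.sigmaEll) :
    Real.cos (J.quasiMomentum lam) = (J.monodromy lam).trace / 2 := by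
  have h' := abs_lt.1 (show |(J.monodromy lam).trace| < 2 from h)
  exact Real.cos_arccos (by linarith) (by linarith)

theorem quasiMomentum_mem_Icc (lam : ℝ) : J.quasiMomentum lam ∈ Set.Icc 0 Real.pi :=
  ⟨Real.arccos_nonneg _, Real.arccos_le_pi _⟩

variable {J} in
theorem IsFloquet.cos_quasiMomentum_sq_eq {lam lam' : ℝ} {ξ ξ' : ℂ} {ψ ψ' : ℕ → ℂ}
    (h : J.IsFloquet lam ξ ψ) (h' : J.IsFloquet lam' ξ' ψ') (hl : lam ∈ J.sigmaEll)
    (hl' : lam' ∈ J.sigmaEll) (hξ : ξ ^ 2 = ξ' ^ 2) :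
    Real.cos (J.quasiMomentum lam) ^ 2 = Real.cos (J.quasiMomentum lam') ^ 2 := by
  rw [J.cos_quasiMomentum hl, J.cos_quasiMomentum hl']
  have h1 := h.multiplier_sq_re
  have h2 := h'.multiplier_sq_re
  rw [hξ] at h1
  linarith

/-- Equal squared cosines mean equal quasi-momenta or quasi-momenta with sum π; either is a rational
relation between members of the independent family. -/
theorem eq_of_cos_quasiMomentum_sq_eq {lam : ℕ+ → ℝ}
    (hindep : ∀ n : ℕ+, 3 ≤ n →
      LinearIndependent ℚ (fun o : Option (Set.Icc (3 : ℕ+) n) =>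
        o.elim Real.pi (fun i => J.quasiMomentum (lam i))))
    {i j : ℕ+} (hi : 3 ≤ i) (hj : 3 ≤ j)
    (h : Real.cos (J.quasiMomentum (lam i)) ^ 2 = Real.cos (J.quasiMomentum (lam j)) ^ 2) :
    i = j := by
  by_contra hij
  have hli := hindep (max i j) (hi.trans (le_max_left _ _))
  set i' : Set.Icc (3 : ℕ+) (max i j) := ⟨i, hi, le_max_left _ _⟩ with hi'
  set j' : Set.Icc (3 : ℕ+) (max i j) := ⟨j, hj, le_max_right _ _⟩ with hj'
  have hij' : i' ≠ j' := fun h => hij (congrArg Subtype.val h)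
  rcases Real.eq_or_add_eq_pi_of_cos_sq_eq (J.quasiMomentum_mem_Icc _)
    (J.quasiMomentum_mem_Icc _) h with h1 | h1
  · have := hli.injective (a₁ := some i') (a₂ := some j') (by simpa [hi', hj'] using h1)
    exact hij' (Option.some_injective _ this)
  · have h2 := linearIndependent_iff'.1 hli {none, some i', some j'}
      (fun o => o.elim 1 fun _ => -1) (by
        rw [Finset.sum_insert (by simp), Finset.sum_insert (by simpa using hij'),
          Finset.sum_singleton]
        simp [hi', hj', ← h1]
        ring) none (by simp)
    simp at h2

theorem op_add_diagOp_apply_eq {U q : ℕ → ℝ} {lam : ℝ}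
    (h1 : (J.b 1 + q 1) * U 1 + J.a 1 * U 2 = lam * U 1)
    (h : ∀ n, J.a (n + 1) * U (n + 1) + (J.b (n + 2) + q (n + 2)) * U (n + 2)
      + J.a (n + 2) * U (n + 3) = lam * U (n + 2)) :
    (J.op + diagOp fun n : ℕ+ => q n) (fun n : ℕ+ => U n) = lam • fun n : ℕ+ => U n := by
  funext n
  have hn : (J.op + diagOp fun n : ℕ+ => q n) (fun n : ℕ+ => U n) n
      = (if 1 < n then J.a ((n : ℕ) - 1) * U ((n - 1 : ℕ+) : ℕ) else 0)
        + J.b n * U n + J.a n * U ((n + 1 : ℕ+) : ℕ) + q n * U n := rfl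
  rw [hn, Pi.smul_apply, smul_eq_mul]
  obtain ⟨k, rfl⟩ : ∃ k : ℕ, n = k.succPNat := ⟨n.natPred, (PNat.succPNat_natPred n).symm⟩
  rcases k with _ | k
  · have e : ¬ (1 : ℕ+) < Nat.succPNat 0 := by decide
    rw [if_neg e]
    simp only [Nat.succPNat_coe, PNat.add_coe, PNat.one_coe, Nat.succ_eq_add_one, zero_add,
      Nat.reduceAdd]
    linarith
  · have e : (1 : ℕ+) < Nat.succPNat (k + 1) := by
      rw [← PNat.coe_lt_coe]; simp
    rw [if_pos e, PNat.sub_coe, if_pos e]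
    simp only [Nat.succPNat_coe, PNat.add_coe, PNat.one_coe, Nat.succ_eq_add_one,
      Nat.add_sub_cancel]
    linarith [h k]

end PeriodicJacobi

/-! ### Conclusion -/

theorem theorem4p2 (T : ℕ+) (J : PeriodicJacobi T) (lam : ℕ+ → ℝ)
    (hell : ∀ i, lam i ∈ J.sigmaEll)
    (hindep : ∀ n : ℕ+, 3 ≤ n →
      LinearIndependent ℚ (fun o : Option (Set.Icc (3 : ℕ+) n) =>
        o.elim Real.pi (fun i => J.quasiMomentum (lam i))))
    (htwo : (0 < J.quasiMomentum (lam 1) ∧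
          J.quasiMomentum (lam 1) < J.quasiMomentum (lam 2) ∧
          J.quasiMomentum (lam 2) < Real.pi / 2) ∨
        (Real.pi / 2 < J.quasiMomentum (lam 1) ∧
          J.quasiMomentum (lam 1) < J.quasiMomentum (lam 2) ∧
          J.quasiMomentum (lam 2) < Real.pi))
    (K : ℕ+ → ℝ) (hKpos : ∀ n, 0 < K n) (hK : Tendsto K atTop atTop) :
    ∃ q : ℕ+ → ℝ, (∀ n : ℕ+, |q n| ≤ K n / (n : ℝ)) ∧ Tendsto q atTop (𝓝 0) ∧
      ∃ u : ℕ+ → lp (fun _ : ℕ+ => ℝ) 2, ∀ i : ℕ+, u i ≠ 0 ∧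
        (J.op + diagOp q) (u i) = lam i • (u i : ℕ+ → ℝ) := by
  choose ξ ψ hF using fun i => J.exists_isFloquet (hell i)
  set C : ℕ+ → ℝ := fun i => Real.cos (J.quasiMomentum (lam i)) ^ 2 with hC
  -- Two different quasi-momenta on the same side of π / 2 neither coincide nor add up to π.
  have hC12 : C 1 ≠ C 2 := by
    intro h
    rcases Real.eq_or_add_eq_pi_of_cos_sq_eq (J.quasiMomentum_mem_Icc _)
      (J.quasiMomentum_mem_Icc _) h with h1 | h1 <;>
    rcases htwo with ⟨_, _, _⟩ | ⟨_, _, _⟩ <;> linarith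
  have hC3 : ∀ i j, 3 ≤ i → 3 ≤ j → C i = C j → i = j := fun i j hi hj h =>
    J.eq_of_cos_quasiMomentum_sq_eq hindep hi hj h
  have hcases : ∀ i : ℕ+, i = 1 ∨ i = 2 ∨ 3 ≤ i := by
    intro i
    have h1 : (i : ℕ) = 1 ∨ (i : ℕ) = 2 ∨ 3 ≤ (i : ℕ) := by have := i.pos; omega
    rcases h1 with h | h | h
    · exact Or.inl (PNat.eq h)
    · exact Or.inr (Or.inl (PNat.eq h))
    · exact Or.inr (Or.inr h)
  -- Three distinct indices would include two that are both at least 3 or the pair 1, 2.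
  have htriple : ∀ i j l, i ≠ l → j ≠ l → C i = C l → C j = C l → i = j := by
    intro i j l hil hjl h1 h2
    rcases hcases i with rfl | rfl | hi <;> rcases hcases j with rfl | rfl | hj <;>
      rcases hcases l with rfl | rfl | hl <;> grind
  -- Values that repeat `lam 1` or `lam 2` need no eigenvector of their own.
  set active : Set ℕ+ := {i | i = 1 ∨ i = 2 ∨ (lam i ≠ lam 1 ∧ lam i ≠ lam 2)} with hactive
  have hlam_ne : ∀ i ∈ active, ∀ j ∈ active, lam i = lam j → i = j := by
    intro i hi j hj h
    have hCC : C i = C j := by simp only [hC, h]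
    simp only [hactive, Set.mem_ofPred_eq] at hi hj
    rcases hcases i with rfl | rfl | hi' <;> rcases hcases j with rfl | rfl | hj' <;> grind
  set K' : ℕ → ℝ := fun n => K n.toPNat' with hK'
  have hK't : Tendsto K' atTop atTop := by
    refine hK.comp (tendsto_atTop.2 fun b => ?_)
    filter_upwards [eventually_ge_atTop (b : ℕ)] with n hn
    rw [← PNat.coe_le_coe, Nat.toPNat'_coe, if_pos (b.pos.trans_le hn)]
    exact hn
  obtain ⟨q, hq, hq0, Z, hZ⟩ := exists_potential (ι := active) T.pos
    (ψ := fun i => ψ i) (ξ := fun i => ξ i) (fun i n => (hF i).quasi_periodic n)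
    (fun i => (hF i).ne_zero 0) (fun i => (hF i).norm_multiplier)
    (fun i => (hF i).multiplier_sq_ne_one (hell i))
    (fun i j l hil hjl h1 h2 => Subtype.ext (htriple i j l (Subtype.coe_ne_coe.2 hil)
      (Subtype.coe_ne_coe.2 hjl) ((hF i).cos_quasiMomentum_sq_eq (hF l) (hell i) (hell l) h1)
      ((hF j).cos_quasiMomentum_sq_eq (hF l) (hell j) (hell l) h2)))
    (fun i l hil z hz => by
      by_contra! hcon
      exact hil (Subtype.ext (hlam_ne i i.2 l l.2 ((hF i).eq_of_sq_eq (hF l) hz hcon))))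
    (K := K') (fun n _ => hKpos _) hK't (z₀ := fun i => starRingEnd ℂ (ψ i 0))
    (fun i => by simpa using (hF i).ne_zero 0)
  refine ⟨fun n => q n, fun n => ?_, hq0.comp (tendsto_atTop.2 fun b => ?_), ?_⟩
  · have := hq n (PNat.pos n)
    simpa only [hK', PNat.coe_toPNat'] using this
  · filter_upwards [eventually_ge_atTop b.succPNat] with n hn
    exact (Nat.le_succ b).trans hn
  have hsol : ∀ i : active, ∃ u : lp (fun _ : ℕ+ => ℝ) 2, u ≠ 0 ∧
      (J.op + diagOp fun n : ℕ+ => q n) u = lam i • (u : ℕ+ → ℝ) := by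
    intro i
    obtain ⟨hZ1, hZs, hsum⟩ := hZ i
    set U : ℕ → ℝ := fun n => (Z i n * ψ i n).im with hU
    obtain ⟨E, hE⟩ := exists_norm_bound_of_multiplier T.pos (hF i).quasi_periodic
      (hF i).norm_multiplier
    have hUsum : Summable fun n => ‖U n‖ ^ 2 := by
      refine Summable.of_nonneg_of_le (fun n => by positivity) (fun n => ?_) (hsum.mul_right (E ^ 2))
      rw [← mul_pow]
      refine pow_le_pow_left₀ (norm_nonneg _) ((Complex.abs_im_le_norm _).trans ?_) 2
      rw [norm_mul]
      gcongr
      exact hE n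
    have hmem : Memℓp (fun n : ℕ+ => U n) 2 := by
      refine memℓp_gen ?_
      simpa [Function.comp_def] using hUsum.comp_injective PNat.coe_injective
    have hrec := (hF i).im_recurrence hZs
    refine ⟨⟨_, hmem⟩, fun h0 => ?_,
      J.op_add_diagOp_apply_eq (U := U) (q := q) (lam := lam i) ?_ fun n => ?_⟩
    · have h1 : U 1 = 0 := congrFun (congrArg Subtype.val h0) 1
      -- Since Z 1 = conj (ψ 0), the Wronskian at 0 reads a 0 * U 1 = 1.
      have w := (hF i).wronskian 0
      rw [zero_add, ← hZ1] at w
      simp only [hU] at h1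
      rw [h1, mul_zero] at w
      exact zero_ne_one w
    · have h1 := hrec 0
      -- The initial coefficient conj (ψ 0) is chosen to make the solution vanish at site 0, which
      -- is the boundary condition in the first row.
      have h2 : (Z i 1 * ψ i 0).im = 0 := by
        rw [hZ1, mul_comm, Complex.mul_conj, Complex.ofReal_im]
      simp only [zero_add] at h1
      rw [h2, mul_zero, zero_add] at h1
      exact h1
    · have h1 := hrec (n + 1)
      rw [show Z i (n + 1 + 1) = _ from hZs (n + 1), im_kick_mul, ← hZs (n + 1)] at h1
      exact h1
  choose u hu using hsol
  have huall : ∀ i : ℕ+, ∃ v : lp (fun _ : ℕ+ => ℝ) 2, v ≠ 0 ∧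
      (J.op + diagOp fun n : ℕ+ => q n) v = lam i • (v : ℕ+ → ℝ) := by
    intro i
    by_cases hi : i ∈ active
    · exact ⟨u ⟨i, hi⟩, hu ⟨i, hi⟩⟩
    · simp only [hactive, Set.mem_ofPred_eq, not_or, not_and_or, not_not] at hi
      rcases hi.2.2 with h | h
      · rw [h]; exact ⟨_, hu ⟨1, Or.inl rfl⟩⟩
      · rw [h]; exact ⟨_, hu ⟨2, Or.inr (Or.inl rfl)⟩⟩
  choose v hv using huall
  exact ⟨v, hv⟩
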